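/- Let $d\ge 2$ be an integer, $s>\tfrac12$ and $\tfrac d2<\alpha<d$. For a function $u:\mathbb R^d\to\mathbb C$ let $D^su$ be defined by $\widehat{D^su}(\xi)=|\xi|^s\,\hat u(\xi)$, where $\hat u(\xi)=\int_{\mathbb R^d}e^{-2\pi i x\cdot\xi}u(x)\,dx$ in the sense of tempered distributions, and let $\dot H^s(\mathbb R^d)$ be the space of tempered functions $u$ such that $\hat u$ is a (locally integrable) function and $D^su\in L^2(\mathbb R^d)$. Put $$X=\Big\{u\in\dot H^s(\mathbb R^d):\ u \text{ is radial},\ \big\||x|^{-\alpha}\star|u|\big\|_{L^2(\mathbb R^d)}<\infty\Big\}.$$ Then for every real number $\sigma$ with $$\frac{2s\left(\frac d2-1\right)+\frac d2}{2s+1}<\sigma<\frac{2s(d-1)-(2s-1)\left(\alpha-\frac d2\right)}{2s+1}$$ there is a constant $C=C(\alpha,s,\sigma,d)>0$ such that every $u\in X$ with $$\|D^su\|_{L^2(\mathbb R^d)}=\big\||x|^{-\alpha}\star|u|\big\|_{L^2(\mathbb R^d)}=1$$ satisfies $$|u(x)|\le C\,|x|^{-\sigma}\qquad\text{for almost every }x\in\mathbb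 R^d.$$ -/

import Mathlib

open MeasureTheory
open scoped ENNReal SchwartzMap FourierTransform

/-- The tempered distribution `T` is the function `f`: every product of `f` with a Schwartz
function is integrable and `T φ = ∫ φ f`. -/
def IsRepresentedBy {d : ℕ} (T : 𝓢'(EuclideanSpace ℝ (Fin d), ℂ))
    (f : EuclideanSpace ℝ (Fin d) → ℂ) : Prop :=
  LocallyIntegrable f volume ∧
    ∀ φ : 𝓢(EuclideanSpace ℝ (Fin d), ℂ),
      Integrable (fun x => φ x * f x) volume ∧ T φ = ∫ x, φ x * f x

/-- `D^s u = v`, that is `v̂(ξ) = |ξ|^s û(ξ)`. The Fourier transforms are those of tempered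
distributions, normalized as `û(ξ) = ∫ e^{-2πi x·ξ} u(x) dx`, and `û` is required to be a function
`g`. -/
def IsFracDeriv {d : ℕ} (s : ℝ) (u v : EuclideanSpace ℝ (Fin d) → ℂ) : Prop :=
  ∃ (U V : 𝓢'(EuclideanSpace ℝ (Fin d), ℂ)) (g : EuclideanSpace ℝ (Fin d) → ℂ),
    IsRepresentedBy U u ∧ IsRepresentedBy V v ∧
    IsRepresentedBy (𝓕 U) g ∧
    IsRepresentedBy (𝓕 V) (fun ξ => ((‖ξ‖ ^ s : ℝ) : ℂ) * g ξ)

/-- `u` belongs to the homogeneous Sobolev space `Ḣ^s(ℝ^d)`: `D^s u` exists and lies in `L²`. -/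
def MemHomogeneousSobolev {d : ℕ} (s : ℝ) (u : EuclideanSpace ℝ (Fin d) → ℂ) : Prop :=
  ∃ v : EuclideanSpace ℝ (Fin d) → ℂ, MemLp v 2 volume ∧ IsFracDeriv s u v

/-- `u` coincides almost everywhere with a function of `|x|`. -/
def IsRadial {d : ℕ} (u : EuclideanSpace ℝ (Fin d) → ℂ) : Prop :=
  ∃ f : ℝ → ℂ, ∀ᵐ x ∂(volume : Measure (EuclideanSpace ℝ (Fin d))), u x = f ‖x‖

/-- The convolution `|x|^{-α} ⋆ |u|`, with values in `[0, ∞]`. -/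
noncomputable def rieszConv {d : ℕ} (α : ℝ) (u : EuclideanSpace ℝ (Fin d) → ℂ) :
    EuclideanSpace ℝ (Fin d) → ℝ≥0∞ :=
  (fun x => ENNReal.ofReal (‖x‖ ^ (-α))) ⋆ₗ[volume] (fun x => ‖u x‖ₑ)

/-- The space `X = X_{s,α,d}` of radial functions in `Ḣ^s(ℝ^d)` with `|x|^{-α} ⋆ |u|` in `L²`. -/
def spaceX (d : ℕ) (s α : ℝ) : Set (EuclideanSpace ℝ (Fin d) → ℂ) :=
  {u | MemHomogeneousSobolev s u ∧ IsRadial u ∧ eLpNorm (rieszConv α u) 2 volume < ∞}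

/-! The argument is by duality: for test functions `ψ` of radial modulus carried by R ≤ |x| ≤ 2R,
one proves |∫ ψ u| ≤ C R^(-σ) ‖ψ‖₁ (`exists_enorm_pairing_le`). Letting `ψ` concentrate on a sphere
then gives the pointwise bound by Lebesgue differentiation in the radius
(`ae_norm_le_of_pairing_le`).

The gain from radiality is geometric. A ball of radius h < R carries at most a fraction of order
(h/R)^(d-1) of a rotation invariant mass lying outside the ball of radius R. Smoothing `ψ` at
frequency λ ≥ 1/R therefore gives a function of size at most λ^d (λR)^(-(d-1)) ‖ψ‖₁ = λ R^(-(d-1))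
‖ψ‖₁, up to a constant, decaying for |y| beyond R.

Split `ψ` at a frequency ρ. The low part is paired with |u| directly: the bound on |x|^(-α) ⋆ |u|
controls the mass of u at scale R by R^(α-d/2) (`exists_lintegral_weight_le`), so this part costs ρ
R^(1-d+α-d/2). For the high part, Cauchy–Schwarz and Plancherel leave the norm of `ψ` in the
homogeneous space of order -s above ρ. Its energy below λ is ⟨ψ, P_λ ψ⟩ ≤ ‖P_λ ψ‖_∞ ‖ψ‖₁, so a
dyadic sum, convergent because s > 1/2, gives the cost ρ^(1/2-s) R^(-(d-1)/2).

For R ≥ 1, balancing the two costs in ρ produces the upper endpoint of the range of σ as decay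
exponent. For R < 1, the cut is made at ρ = 1, and only part of the radial gain is used in the high
part. -/

/-! ### Polar coordinates and the mass of balls under radial measures. -/

section Polar

open scoped Pointwise

variable {E : Type*} [NormedAddCommGroup E] [NormedSpace ℝ E] [MeasurableSpace E] [BorelSpace E]
  [FiniteDimensional ℝ E] [Nontrivial E] (μ : Measure E) [μ.IsAddHaarMeasure]

/-- Integration in polar coordinates, for the Lebesgue integral. -/
theorem lintegral_eq_lintegral_polar {F : E → ℝ≥0∞} (hF : Measurable F) :
    ∫⁻ x, F x ∂μ = ∫⁻ r : Set.Ioi (0 : ℝ), ∫⁻ θ : Metric.sphere (0 : E) 1,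
      F ((r : ℝ) • (θ : E)) ∂μ.toSphere
        ∂(Measure.volumeIoiPow (Module.finrank ℝ E - 1)) := by
  have h1 : ∫⁻ x, F x ∂μ = ∫⁻ x : ({(0)}ᶜ : Set E), F x ∂(μ.comap (↑)) := by
    rw [lintegral_subtype_comap (measurableSet_singleton _).compl, restrict_compl_singleton]
  have hm : Measurable fun p : Metric.sphere (0 : E) 1 × Set.Ioi (0 : ℝ) =>
      F ((p.2 : ℝ) • (p.1 : E)) := hF.comp (by fun_prop)
  rw [h1, ← lintegral_prod_symm' _ hm,
    ← (μ.measurePreserving_homeomorphUnitSphereProd).lintegral_comp hm]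
  refine lintegral_congr fun x => ?_
  congr 1
  have hx : ‖(x : E)‖ ≠ 0 := norm_ne_zero_iff.2 x.2
  simp [smul_smul, hx]

/-- A spherical cap of radius `δ` has measure at most a constant times `δ ^ (dim E - 1)`. -/
theorem exists_toSphere_cap_le : ∃ C : ℝ, 0 ≤ C ∧ ∀ (θ₀ : Metric.sphere (0 : E) 1) (δ : ℝ), 0 < δ →
    μ.toSphere {θ | ‖(θ : E) - θ₀‖ < δ} ≤ ENNReal.ofReal (C * δ ^ (Module.finrank ℝ E - 1)) := by
  set n := Module.finrank ℝ E with hn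
  have hn1 : 1 ≤ n := Module.finrank_pos
  set c := μ.real (Metric.ball 0 1)
  have hc : 0 ≤ c := measureReal_nonneg
  refine ⟨n * 2 ^ (n + 1) * c, by positivity, fun θ₀ δ hδ => ?_⟩
  rcases le_or_gt 1 δ with h1 | h1
  · calc μ.toSphere {θ | ‖(θ : E) - θ₀‖ < δ} ≤ μ.toSphere Set.univ := measure_mono (Set.subset_univ _)
      _ = ENNReal.ofReal (n * c) := by
        rw [← μ.toSphere_real_apply_univ, ofReal_measureReal]
      _ ≤ _ := by
        apply ENNReal.ofReal_le_ofReal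
        have h2 : (1 : ℝ) ≤ 2 ^ (n + 1) * δ ^ (n - 1) :=
          one_le_mul_of_one_le_of_one_le (one_le_pow₀ (by norm_num)) (one_le_pow₀ h1)
        calc (n : ℝ) * c = n * c * 1 := by ring
          _ ≤ n * c * (2 ^ (n + 1) * δ ^ (n - 1)) := by gcongr
          _ = _ := by ring
  · have hmeas : MeasurableSet {θ : Metric.sphere (0 : E) 1 | ‖(θ : E) - θ₀‖ < δ} :=
      measurableSet_lt (by fun_prop) (by fun_prop)
    rw [μ.toSphere_apply' hmeas]
    -- The spherical measure of the cap is n times the volume of the cone over it. About 1/δ balls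
    -- of radius 2δ centred along the axis cover this cone, each of volume comparable to δ^n.
    set N := ⌊1 / δ⌋₊
    have hcover : Set.Ioo (0 : ℝ) 1 • ((↑) '' {θ : Metric.sphere (0 : E) 1 | ‖(θ : E) - θ₀‖ < δ}) ⊆
        ⋃ k ∈ Finset.range (N + 1), Metric.ball ((k * δ) • (θ₀ : E)) (2 * δ) := by
      rintro _ ⟨t, ht, _, ⟨θ, hθ, rfl⟩, rfl⟩
      have hθ' : ‖(θ : E) - θ₀‖ < δ := hθ
      simp only [Set.mem_iUnion, Finset.mem_range, Metric.mem_ball, dist_eq_norm]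
      refine ⟨⌊t / δ⌋₊, ?_, ?_⟩
      · have : ⌊t / δ⌋₊ ≤ N := Nat.floor_mono (by gcongr; exact ht.2.le)
        omega
      · have hk1 : (⌊t / δ⌋₊ : ℝ) ≤ t / δ := Nat.floor_le (div_nonneg ht.1.le hδ.le)
        have hk2 : t / δ < ⌊t / δ⌋₊ + 1 := Nat.lt_floor_add_one _
        rw [le_div_iff₀ hδ] at hk1
        rw [div_lt_iff₀ hδ] at hk2
        have hs : ‖(θ₀ : E)‖ = 1 := by simp
        calc ‖t • (θ : E) - (⌊t / δ⌋₊ * δ) • (θ₀ : E)‖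
            = ‖t • ((θ : E) - θ₀) + (t - ⌊t / δ⌋₊ * δ) • (θ₀ : E)‖ := by
              congr 1; rw [smul_sub, sub_smul]; abel
          _ ≤ t * ‖(θ : E) - θ₀‖ + (t - ⌊t / δ⌋₊ * δ) * 1 := by
              refine (norm_add_le _ _).trans ?_
              rw [norm_smul, norm_smul, hs, Real.norm_of_nonneg ht.1.le,
                Real.norm_of_nonneg (by linarith)]
          _ < 2 * δ := by nlinarith [ht.1, ht.2, norm_nonneg ((θ : E) - θ₀)]
    have hball : ∀ x : E, μ (Metric.ball x (2 * δ)) = ENNReal.ofReal ((2 * δ) ^ n * c) := by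
      intro x
      rw [Measure.addHaar_ball_of_pos _ _ (by positivity), ENNReal.ofReal_mul (by positivity),
        ofReal_measureReal measure_ball_lt_top.ne]
    calc (n : ℝ≥0∞) * μ (Set.Ioo (0 : ℝ) 1 • ((↑) '' {θ : Metric.sphere (0 : E) 1 | ‖(θ : E) - θ₀‖ < δ}))
        ≤ n * ∑ k ∈ Finset.range (N + 1), μ (Metric.ball ((k * δ) • (θ₀ : E)) (2 * δ)) := by
          gcongr
          exact (measure_mono hcover).trans (measure_biUnion_finset_le _ _)
      _ = ENNReal.ofReal (n * ((N + 1) * ((2 * δ) ^ n * c))) := by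
          simp only [hball, Finset.sum_const, Finset.card_range, nsmul_eq_mul]
          rw [ENNReal.ofReal_mul (p := (n : ℝ)) (by positivity),
            ENNReal.ofReal_mul (p := (N : ℝ) + 1) (by positivity),
            ENNReal.ofReal_natCast, ← Nat.cast_add_one, ENNReal.ofReal_natCast]
      _ ≤ _ := by
          apply ENNReal.ofReal_le_ofReal
          have hN : (N : ℝ) ≤ 1 / δ := Nat.floor_le (by positivity)
          have hN' : (N : ℝ) * δ ≤ 1 := by rwa [le_div_iff₀ hδ] at hN
          have hp : δ ^ n = δ ^ (n - 1) * δ := by rw [← pow_succ, Nat.sub_add_cancel hn1]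
          calc (n : ℝ) * ((N + 1) * ((2 * δ) ^ n * c))
              = n * c * 2 ^ n * δ ^ (n - 1) * (N * δ + δ) := by rw [mul_pow, hp]; ring
            _ ≤ n * c * 2 ^ n * δ ^ (n - 1) * 2 := by gcongr; linarith
            _ = _ := by ring

/-- A rotation invariant measure carried by `{R ≤ ‖x‖}` gives to a ball of radius `h` at most a
constant times `(h / R) ^ β` of its mass, `0 ≤ β ≤ dim E - 1`. -/
theorem exists_setLIntegral_ball_radial_le : ∃ C : ℝ, 0 ≤ C ∧
    ∀ (β : ℝ), 0 ≤ β → β ≤ Module.finrank ℝ E - 1 →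
    ∀ (η : ℝ → ℝ≥0∞), Measurable η → ∀ R : ℝ, 0 < R → (∀ r, r < R → η r = 0) →
    ∀ (x : E) (h : ℝ), 0 < h →
      ∫⁻ y in Metric.ball x h, η ‖y‖ ∂μ ≤
        ENNReal.ofReal (C * (h / R) ^ β) * ∫⁻ y, η ‖y‖ ∂μ := by
  obtain ⟨C, hC, hcap⟩ := exists_toSphere_cap_le μ
  set n := Module.finrank ℝ E with hn
  have hn1 : 1 ≤ n := Module.finrank_pos
  set S := μ.toSphere.real Set.univ
  have hS : 0 < S := by
    have : NeZero μ.toSphere := ⟨μ.toSphere_ne_zero⟩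
    exact measureReal_univ_pos
  refine ⟨max 1 (C * 2 ^ (n - 1) / S), by positivity, fun β hβ hβ' η hη R hR hsupp x h hh => ?_⟩
  -- For h ≥ R the factor (h/R)^β is at least 1 and nothing is to prove. For h < R the geometric
  -- gain has exponent n - 1, and a smaller β only weakens it.
  rcases le_or_gt R h with hRh | hRh
  · refine (setLIntegral_le_lintegral _ _).trans ?_
    conv_lhs => rw [← one_mul (∫⁻ y, η ‖y‖ ∂μ)]
    gcongr
    rw [← ENNReal.ofReal_one]
    apply ENNReal.ofReal_le_ofReal
    exact one_le_mul_of_one_le_of_one_le (le_max_left _ _)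
      (Real.one_le_rpow ((one_le_div hR).2 hRh) hβ)
  have hmη : Measurable fun y : E => η ‖y‖ := hη.comp measurable_norm
  have hmF : Measurable ((Metric.ball x h).indicator fun y : E => η ‖y‖) :=
    hmη.indicator measurableSet_ball
  have hpow : (h / R) ^ (n - 1) ≤ (h / R) ^ β := by
    rw [← Real.rpow_natCast, Nat.cast_sub hn1, Nat.cast_one]
    exact Real.rpow_le_rpow_of_exponent_ge (by positivity) ((div_le_one hR).2 hRh.le) hβ'
  have hkey : ∀ r : Set.Ioi (0 : ℝ), ∫⁻ θ : Metric.sphere (0 : E) 1,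
      (Metric.ball x h).indicator (fun y : E => η ‖y‖) ((r : ℝ) • (θ : E)) ∂μ.toSphere ≤
      ENNReal.ofReal (C * (2 * (h / R)) ^ (n - 1)) * η r := by
    rintro ⟨r, hr⟩
    have hr : 0 < r := hr
    simp only
    rcases lt_or_ge r R with hrR | hrR
    · have : ∀ θ : Metric.sphere (0 : E) 1,
          (Metric.ball x h).indicator (fun y : E => η ‖y‖) (r • (θ : E)) = 0 := by
        intro θ
        apply Set.indicator_apply_eq_zero.2
        intro _
        simp [norm_smul, abs_of_pos hr, hsupp r hrR]
      simp [this]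
    have hle : ∀ θ : Metric.sphere (0 : E) 1,
        (Metric.ball x h).indicator (fun y : E => η ‖y‖) (r • (θ : E)) =
        {θ : Metric.sphere (0 : E) 1 | r • (θ : E) ∈ Metric.ball x h}.indicator
          (fun _ => η r) θ := by
      intro θ
      by_cases hθ : r • (θ : E) ∈ Metric.ball x h <;>
        simp [Set.indicator, norm_smul, abs_of_pos hr]
    have hmeas : MeasurableSet {θ : Metric.sphere (0 : E) 1 | r • (θ : E) ∈ Metric.ball x h} :=
      measurableSet_ball.preimage (by fun_prop)
    simp only [hle]
    rw [lintegral_indicator_const hmeas, mul_comm]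
    refine mul_le_mul_left ?_ _
    rcases Set.eq_empty_or_nonempty {θ : Metric.sphere (0 : E) 1 | r • (θ : E) ∈ Metric.ball x h}
      with h0 | ⟨θ₀, hθ₀⟩
    · rw [h0, measure_empty]
      exact zero_le
    -- The cap is centred at a point of the slice itself rather than at the direction of `x`, which
    -- may be 0; this doubles its radius.
    refine (measure_mono (t := {θ : Metric.sphere (0 : E) 1 | ‖(θ : E) - θ₀‖ < 2 * (h / r)})
      ?_).trans
      ((hcap θ₀ (2 * (h / r)) (by positivity)).trans ?_)
    · intro θ hθ
      simp only [Set.mem_ofPred_eq, Metric.mem_ball] at hθ hθ₀ ⊢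
      have h3 : dist (r • (θ : E)) (r • (θ₀ : E)) < 2 * h := by
        calc _ ≤ dist (r • (θ : E)) x + dist (r • (θ₀ : E)) x := dist_triangle_right _ _ _
          _ < 2 * h := by linarith
      rw [dist_eq_norm, ← smul_sub, norm_smul, Real.norm_of_nonneg hr.le] at h3
      rw [← mul_div_assoc, lt_div_iff₀ hr]
      linarith
    · apply ENNReal.ofReal_le_ofReal
      gcongr
  calc ∫⁻ y in Metric.ball x h, η ‖y‖ ∂μ
      = ∫⁻ y, (Metric.ball x h).indicator (fun y : E => η ‖y‖) y ∂μ :=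
        (lintegral_indicator measurableSet_ball _).symm
    _ ≤ ∫⁻ r : Set.Ioi (0 : ℝ), ENNReal.ofReal (C * (2 * (h / R)) ^ (n - 1)) * η r
          ∂(Measure.volumeIoiPow (n - 1)) := by
        rw [lintegral_eq_lintegral_polar μ hmF]
        exact lintegral_mono hkey
    _ = ENNReal.ofReal (C * (2 * (h / R)) ^ (n - 1) / S) * ∫⁻ y, η ‖y‖ ∂μ := by
        rw [lintegral_const_mul _ (by fun_prop), lintegral_eq_lintegral_polar μ hmη]
        have : ∀ r : Set.Ioi (0 : ℝ), ∫⁻ θ : Metric.sphere (0 : E) 1,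
            η ‖(r : ℝ) • (θ : E)‖ ∂μ.toSphere = η r * ENNReal.ofReal S := by
          rintro ⟨r, hr⟩
          have hr : 0 < r := hr
          simp only [norm_smul, norm_eq_of_mem_sphere, mul_one, Real.norm_of_nonneg hr.le,
            lintegral_const]
          rw [ofReal_measureReal]
        simp only [this]
        rw [lintegral_mul_const _ (by fun_prop), mul_comm (∫⁻ _, _ ∂_), ← mul_assoc,
          ← ENNReal.ofReal_mul (by positivity), div_mul_cancel₀ _ hS.ne']
    _ ≤ _ := by
        gcongr
        calc C * (2 * (h / R)) ^ (n - 1) / S = (C * 2 ^ (n - 1) / S) * (h / R) ^ (n - 1) := by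
              rw [mul_pow]; ring
          _ ≤ _ := by gcongr; exact le_max_right _ _

end Polar

/-- If `ν (ball x h) ≤ A h ^ β` for all `h > 0`, then a bump of width `1 / lam` decaying faster
than the power `β + 1` has `ν`-integral at most a constant times `A lam ^ (-β)`. -/
theorem exists_lintegral_decay_le (β : ℝ) (M : ℕ) (hM : β + 1 < M) : ∃ S : ℝ, 0 ≤ S ∧
    ∀ {X : Type*} [PseudoMetricSpace X] [MeasurableSpace X] [BorelSpace X] (ν : Measure X)
      (x : X) (A : ℝ≥0∞), (∀ h : ℝ, 0 < h → ν (Metric.ball x h) ≤ A * ENNReal.ofReal (h ^ β)) →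
      ∀ lam : ℝ, 0 < lam → ∫⁻ y, ENNReal.ofReal (((1 + lam * dist x y) ^ M)⁻¹) ∂ν ≤
        ENNReal.ofReal (S * lam ^ (-β)) * A := by
  have hsum : Summable fun k : ℕ => ((k : ℝ) + 1) ^ (β - M) := by
    have h1 : Summable fun k : ℕ => ((k : ℝ)) ^ (β - M) :=
      Real.summable_nat_rpow.2 (by linarith)
    simpa using (summable_nat_add_iff 1).2 h1
  have hpos : ∀ k : ℕ, 0 ≤ ((k : ℝ) + 1) ^ (β - M) := fun k => by positivity
  refine ⟨∑' k : ℕ, ((k : ℝ) + 1) ^ (β - M), tsum_nonneg hpos, ?_⟩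
  intro X _ _ _ ν x A hν lam hlam
  -- Only the term k = ⌊lam * dist x y⌋ is needed. Using whole balls instead of shells leaves the
  -- series of (k+1)^(β-M), hence the requirement β + 1 < M.
  have hpt : ∀ y, ENNReal.ofReal (((1 + lam * dist x y) ^ M)⁻¹) ≤
      ∑' k : ℕ, (Metric.ball x ((k + 1) / lam)).indicator
        (fun _ => ENNReal.ofReal ((((k : ℝ) + 1) ^ M)⁻¹)) y := by
    intro y
    refine le_trans ?_ (ENNReal.le_tsum ⌊lam * dist x y⌋₊)
    have h1 : lam * dist x y < ⌊lam * dist x y⌋₊ + 1 := Nat.lt_floor_add_one _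
    have h2 : (⌊lam * dist x y⌋₊ : ℝ) ≤ lam * dist x y := Nat.floor_le (by positivity)
    rw [Set.indicator_of_mem]
    · exact ENNReal.ofReal_le_ofReal (inv_anti₀ (by positivity)
        (pow_le_pow_left₀ (by positivity) (by linarith) _))
    · rw [Metric.mem_ball, dist_comm, lt_div_iff₀ hlam]
      linarith
  calc ∫⁻ y, ENNReal.ofReal (((1 + lam * dist x y) ^ M)⁻¹) ∂ν
      ≤ ∑' k : ℕ, ∫⁻ y, (Metric.ball x ((k + 1) / lam)).indicator
        (fun _ => ENNReal.ofReal ((((k : ℝ) + 1) ^ M)⁻¹)) y ∂ν := by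
        rw [← lintegral_tsum fun k =>
          (measurable_const.indicator measurableSet_ball).aemeasurable]
        exact lintegral_mono hpt
    _ ≤ ∑' k : ℕ, ENNReal.ofReal (((k : ℝ) + 1) ^ (β - M)) * (ENNReal.ofReal (lam ^ (-β)) * A) := by
        refine ENNReal.tsum_le_tsum fun k => ?_
        have hk : (0 : ℝ) < k + 1 := by positivity
        rw [lintegral_indicator_const measurableSet_ball]
        calc _ ≤ ENNReal.ofReal ((((k : ℝ) + 1) ^ M)⁻¹) *
              (A * ENNReal.ofReal (((k + 1) / lam) ^ β)) := by
              gcongr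
              exact hν _ (by positivity)
          _ = ENNReal.ofReal ((((k : ℝ) + 1) ^ M)⁻¹ * ((k + 1) / lam) ^ β) * A := by
              rw [ENNReal.ofReal_mul (by positivity)]; ring
          _ = ENNReal.ofReal (((k : ℝ) + 1) ^ (β - M) * lam ^ (-β)) * A := by
              congr 2
              rw [Real.div_rpow hk.le hlam.le, Real.rpow_sub hk, Real.rpow_natCast,
                Real.rpow_neg hlam.le]
              field_simp
          _ = _ := by
              rw [ENNReal.ofReal_mul (by positivity)]; ring
    _ = _ := by
        rw [ENNReal.tsum_mul_right, ← ENNReal.ofReal_tsum_of_nonneg hpos hsum,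
          ENNReal.ofReal_mul (tsum_nonneg hpos), mul_assoc]

/-! ### Smooth frequency cutoffs and low frequency parts. -/

/-- `b` is a smooth Fourier cutoff at frequency `lam`: it takes values in `[0, 1]`, equals `1` on
`{‖ξ‖ ≤ lam}`, and its Fourier transform has width `1 / lam`. -/
structure IsLowPass {d : ℕ} (M : ℕ) (A lam : ℝ) (b : 𝓢(EuclideanSpace ℝ (Fin d), ℂ)) : Prop where
  exists_real : ∀ ξ, ∃ t : ℝ, 0 ≤ t ∧ t ≤ 1 ∧ b ξ = t
  eq_one : ∀ ξ, ‖ξ‖ ≤ lam → b ξ = 1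
  norm_fourier_le : ∀ z, ‖𝓕 b z‖ ≤ A * lam ^ d * ((1 + lam * ‖z‖) ^ M)⁻¹

theorem exists_one_add_norm_pow_mul_le {d : ℕ} (M : ℕ) (f : 𝓢(EuclideanSpace ℝ (Fin d), ℂ)) :
    ∃ A : ℝ, 0 ≤ A ∧ ∀ z, ‖f z‖ ≤ A * ((1 + ‖z‖) ^ M)⁻¹ := by
  refine ⟨2 ^ M * ((Finset.Iic (M, 0)).sup fun m => SchwartzMap.seminorm ℝ m.1 m.2) f,
    by positivity, fun z => ?_⟩
  have h := SchwartzMap.one_add_le_sup_seminorm_apply (𝕜 := ℝ) (m := (M, 0)) le_rfl le_rfl f z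
  rw [norm_iteratedFDeriv_zero] at h
  rw [← div_eq_mul_inv, le_div_iff₀ (by positivity), mul_comm]
  exact h

/-- All cutoffs are dilates of one bump, and dilation by lam turns its transform into lam^d times
the transform at lam z. This is why one constant serves every frequency. -/
theorem exists_isLowPass (d M : ℕ) : ∃ A : ℝ, 0 ≤ A ∧ ∀ lam : ℝ, 0 < lam →
    ∃ b : 𝓢(EuclideanSpace ℝ (Fin d), ℂ), IsLowPass M A lam b := by
  let β : ContDiffBump (0 : EuclideanSpace ℝ (Fin d)) := ⟨1, 2, one_pos, one_lt_two⟩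
  have hsupp : HasCompactSupport fun ξ => ((β ξ : ℝ) : ℂ) :=
    β.hasCompactSupport.comp_left (g := fun t : ℝ => (t : ℂ)) Complex.ofReal_zero
  have hsm : ContDiff ℝ (⊤ : ℕ∞) fun ξ => ((β ξ : ℝ) : ℂ) :=
    Complex.ofRealCLM.contDiff.comp β.contDiff
  let b₁ : 𝓢(EuclideanSpace ℝ (Fin d), ℂ) := hsupp.toSchwartzMap hsm
  obtain ⟨A, hA, hdecay⟩ := exists_one_add_norm_pow_mul_le M (𝓕 b₁)
  refine ⟨A, hA, fun lam hlam => ?_⟩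
  have hsupp' : HasCompactSupport fun ξ => ((β (lam⁻¹ • ξ) : ℝ) : ℂ) :=
    hsupp.comp_smul (inv_ne_zero hlam.ne')
  have hsm' : ContDiff ℝ (⊤ : ℕ∞) fun ξ => ((β (lam⁻¹ • ξ) : ℝ) : ℂ) :=
    hsm.comp (contDiff_const_smul _)
  refine ⟨hsupp'.toSchwartzMap hsm', ⟨fun ξ => ⟨β (lam⁻¹ • ξ), β.nonneg, β.le_one, rfl⟩, ?_, ?_⟩⟩
  · intro ξ hξ
    have : β (lam⁻¹ • ξ) = 1 := by
      apply β.one_of_mem_closedBall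
      rw [mem_closedBall_zero_iff, norm_smul, norm_inv, Real.norm_of_nonneg hlam.le]
      exact (inv_mul_le_one₀ hlam).2 hξ
    simp [this]
  · intro z
    have hscale : 𝓕 (hsupp'.toSchwartzMap hsm') z = (lam ^ d : ℝ) • 𝓕 b₁ (lam • z) := by
      rw [SchwartzMap.fourier_coe, SchwartzMap.fourier_coe, Real.fourier_eq, Real.fourier_eq]
      have h := Measure.integral_comp_smul (volume : Measure (EuclideanSpace ℝ (Fin d)))
        (fun ξ => Real.fourierChar (-inner ℝ ξ (lam • z)) • b₁ ξ) lam⁻¹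
      rw [finrank_euclideanSpace_fin, inv_pow, inv_inv, abs_of_pos (by positivity)] at h
      rw [← h]
      refine integral_congr_ae (.of_forall fun ξ => ?_)
      simp only [inner_smul_left, inner_smul_right]
      simp [b₁, hlam.ne']
    rw [hscale, norm_smul, Real.norm_of_nonneg (by positivity)]
    have h := hdecay (lam • z)
    rw [norm_smul, Real.norm_of_nonneg hlam.le] at h
    calc lam ^ d * ‖𝓕 b₁ (lam • z)‖ ≤ lam ^ d * (A * ((1 + lam * ‖z‖) ^ M)⁻¹) := by gcongr
      _ = _ := by ring

section LowPart

variable {d : ℕ}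

/-- The low frequency part of `ψ` with respect to the cutoff `b`. -/
noncomputable def lowPart (b ψ : 𝓢(EuclideanSpace ℝ (Fin d), ℂ)) :
    𝓢(EuclideanSpace ℝ (Fin d), ℂ) :=
  SchwartzMap.convolution (ContinuousLinearMap.mul ℂ ℂ) (𝓕 b) ψ

variable (b ψ : 𝓢(EuclideanSpace ℝ (Fin d), ℂ))

/-- The inverse transform is the relevant one: pairing u with `ψ` amounts to pairing the transform
of u with `𝓕⁻ ψ`. -/
theorem fourierInv_lowPart (ξ : EuclideanSpace ℝ (Fin d)) :
    𝓕⁻ (lowPart b ψ) ξ = b ξ * 𝓕⁻ ψ ξ := by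
  have h1 : ∀ f : 𝓢(EuclideanSpace ℝ (Fin d), ℂ), 𝓕⁻ f ξ = 𝓕 f (-ξ) := fun f => by
    rw [SchwartzMap.fourierInv_coe, Real.fourierInv_eq_fourier_neg, SchwartzMap.fourier_coe]
  have h2 : b ξ = 𝓕 (𝓕 b) (-ξ) := by rw [← h1, FourierTransform.fourierInv_fourier_eq]
  rw [h1, h1, h2, lowPart, SchwartzMap.fourier_convolution]
  simp

theorem lowPart_apply (y : EuclideanSpace ℝ (Fin d)) :
    lowPart b ψ y = ∫ x, 𝓕 b (y - x) * ψ x := by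
  rw [lowPart, SchwartzMap.convolution_apply, convolution_eq_swap]
  simp

theorem enorm_lowPart_le (y : EuclideanSpace ℝ (Fin d)) :
    ‖lowPart b ψ y‖ₑ ≤ ∫⁻ x, ‖𝓕 b (y - x)‖ₑ * ‖ψ x‖ₑ := by
  rw [lowPart_apply]
  refine (enorm_integral_le_lintegral_enorm _).trans_eq ?_
  simp only [enorm_mul]

variable {b ψ}

/-- A TTᵀ-type argument: since `b` is nonnegative, the left side is by Plancherel the inner product
of `ψ` with its low part, and L¹–L^∞ duality applies. -/
theorem lintegral_cutoff_mul_fourierInv_sq_le {M : ℕ} {A lam : ℝ} (hb : IsLowPass M A lam b)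
    {K : ℝ≥0∞} (hK : ∀ y, ‖lowPart b ψ y‖ₑ ≤ K) :
    ∫⁻ ξ, ‖b ξ‖ₑ * ‖𝓕⁻ ψ ξ‖ₑ ^ 2 ≤ K * ∫⁻ x, ‖ψ x‖ₑ := by
  have hpl : ∫ ξ, inner ℂ (𝓕⁻ ψ ξ) (𝓕⁻ (lowPart b ψ) ξ) = ∫ x, inner ℂ (ψ x) (lowPart b ψ x) := by
    have := SchwartzMap.integral_inner_fourier_fourier (𝓕⁻ ψ) (𝓕⁻ (lowPart b ψ))
    simpa only [FourierTransform.fourier_fourierInv_eq] using this.symm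
  have hpt : ∀ ξ, inner ℂ (𝓕⁻ ψ ξ) (𝓕⁻ (lowPart b ψ) ξ) = ((‖b ξ‖ * ‖𝓕⁻ ψ ξ‖ ^ 2 : ℝ) : ℂ) := by
    intro ξ
    obtain ⟨t, ht0, -, ht⟩ := hb.exists_real ξ
    rw [fourierInv_lowPart, ht]
    simp only [RCLike.inner_apply, Complex.norm_real, Real.norm_of_nonneg ht0]
    push_cast
    rw [mul_assoc, Complex.mul_conj, Complex.normSq_eq_norm_sq]
    push_cast
    ring
  have hnn : ∀ ξ, 0 ≤ ‖b ξ‖ * ‖𝓕⁻ ψ ξ‖ ^ 2 := fun ξ => by positivity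
  have hint : Integrable fun ξ => ‖b ξ‖ * ‖𝓕⁻ ψ ξ‖ ^ 2 := by
    have h1 : Integrable fun ξ => 𝓕⁻ (lowPart b ψ) ξ * 𝓕⁻ ψ ξ :=
      (SchwartzMap.integrable (SchwartzMap.pairing (ContinuousLinearMap.mul ℂ ℂ)
        (𝓕⁻ (lowPart b ψ)) (𝓕⁻ ψ)))
    refine h1.norm.congr (.of_forall fun ξ => ?_)
    simp only [fourierInv_lowPart, norm_mul]
    ring
  have heq : ∫⁻ ξ, ‖b ξ‖ₑ * ‖𝓕⁻ ψ ξ‖ₑ ^ 2 = ‖∫ x, inner ℂ (ψ x) (lowPart b ψ x)‖ₑ := by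
    rw [← hpl]
    simp only [hpt]
    rw [integral_complex_ofReal, ← ofReal_norm, Complex.norm_real,
      Real.norm_of_nonneg (integral_nonneg hnn), ofReal_integral_eq_lintegral_ofReal hint
        (.of_forall hnn)]
    refine lintegral_congr fun ξ => ?_
    rw [ENNReal.ofReal_mul (norm_nonneg _), ENNReal.ofReal_pow (norm_nonneg _),
      ofReal_norm, ofReal_norm]
  rw [heq]
  refine (enorm_integral_le_lintegral_enorm _).trans ?_
  rw [← lintegral_const_mul _ (by fun_prop)]
  refine lintegral_mono fun x => ?_
  simp only [RCLike.inner_apply, enorm_mul, RCLike.enorm_conj]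
  gcongr
  exact hK x

end LowPart

/-- Uniform bound for the low frequency part of a function of radial modulus carried by
`{R ≤ ‖x‖}`. -/
theorem exists_enorm_lowPart_le {d : ℕ} (hd : 2 ≤ d) (A β : ℝ) (hA : 0 ≤ A) (hβ : 0 ≤ β)
    (hβ' : β ≤ d - 1) :
    ∃ C : ℝ, 0 ≤ C ∧ ∀ (lam R : ℝ), 0 < lam → 0 < R →
      ∀ b ψ : 𝓢(EuclideanSpace ℝ (Fin d), ℂ), IsLowPass (d + 1) A lam b →
      ∀ η : ℝ → ℝ≥0∞, Measurable η → (∀ r, r < R → η r = 0) → (∀ x, ‖ψ x‖ₑ = η ‖x‖) →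
      ∀ y, ‖lowPart b ψ y‖ₑ ≤
        ENNReal.ofReal (C * lam ^ d * (lam * R) ^ (-β)) * ∫⁻ x, ‖ψ x‖ₑ := by
  have : Nontrivial (EuclideanSpace ℝ (Fin d)) := by
    have : Nonempty (Fin d) := ⟨⟨0, by omega⟩⟩
    infer_instance
  obtain ⟨C₁, hC₁, hball⟩ := exists_setLIntegral_ball_radial_le
    (volume : Measure (EuclideanSpace ℝ (Fin d)))
  -- The decay d + 1 of the kernel suffices because β + 1 ≤ d. The lemma is applied to the measure
  -- |ψ| dx.
  obtain ⟨S, hS, hdecay⟩ := exists_lintegral_decay_le β (d + 1) (by push_cast; linarith)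
  refine ⟨A * S * C₁, by positivity, fun lam R hlam hR b ψ hb η hη hsupp hψ y => ?_⟩
  have hηm : Measurable fun x : EuclideanSpace ℝ (Fin d) => η ‖x‖ := hη.comp measurable_norm
  set N := ∫⁻ x, ‖ψ x‖ₑ with hN
  have hν := hdecay ((volume : Measure (EuclideanSpace ℝ (Fin d))).withDensity fun x => η ‖x‖) y
    (ENNReal.ofReal (C₁ * R ^ (-β)) * N) (fun h hh => ?_) lam hlam
  · rw [lintegral_withDensity_eq_lintegral_mul _ hηm (by fun_prop)] at hν
    calc ‖lowPart b ψ y‖ₑ ≤ ∫⁻ x, ‖𝓕 b (y - x)‖ₑ * ‖ψ x‖ₑ := enorm_lowPart_le b ψ y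
      _ ≤ ∫⁻ x, ENNReal.ofReal (A * lam ^ d) *
          (((fun x : EuclideanSpace ℝ (Fin d) => η ‖x‖) * fun x =>
            ENNReal.ofReal (((1 + lam * dist y x) ^ (d + 1))⁻¹)) x) := by
          refine lintegral_mono fun x => ?_
          simp only [Pi.mul_apply]
          rw [hψ, ← ofReal_norm, mul_left_comm, mul_comm,
            ← ENNReal.ofReal_mul (by positivity), dist_eq_norm]
          gcongr
          exact hb.norm_fourier_le _
      _ = ENNReal.ofReal (A * lam ^ d) * ∫⁻ x, ((fun x : EuclideanSpace ℝ (Fin d) => η ‖x‖) * fun x =>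
            ENNReal.ofReal (((1 + lam * dist y x) ^ (d + 1))⁻¹)) x := by
          rw [lintegral_const_mul _ (hηm.mul (by fun_prop))]
      _ ≤ ENNReal.ofReal (A * lam ^ d) * (ENNReal.ofReal (S * lam ^ (-β)) *
            (ENNReal.ofReal (C₁ * R ^ (-β)) * N)) := by gcongr
      _ = _ := by
          rw [← mul_assoc, ← mul_assoc, ← ENNReal.ofReal_mul (by positivity),
            ← ENNReal.ofReal_mul (by positivity), Real.mul_rpow hlam.le hR.le]
          congr 2
          ring
  · rw [withDensity_apply _ measurableSet_ball]
    refine (hball β hβ (by simpa using hβ') η hη R hR hsupp y h hh).trans_eq ?_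
    rw [Real.div_rpow hh.le hR.le, Real.rpow_neg hR.le, hN]
    simp only [hψ]
    rw [mul_right_comm, ← ENNReal.ofReal_mul (by positivity)]
    congr 2
    rw [div_eq_mul_inv]
    ring

theorem IsLowPass.enorm_lowPart_le_of_kernel_le {d M : ℕ} {A lam : ℝ}
    {b ψ : 𝓢(EuclideanSpace ℝ (Fin d), ℂ)} (hb : IsLowPass M A lam b)
    {y : EuclideanSpace ℝ (Fin d)} {B : ℝ}
    (hB : ∀ x, ψ x ≠ 0 → A * lam ^ d * ((1 + lam * ‖y - x‖) ^ M)⁻¹ ≤ B) :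
    ‖lowPart b ψ y‖ₑ ≤ ENNReal.ofReal B * ∫⁻ x, ‖ψ x‖ₑ := by
  refine (enorm_lowPart_le b ψ y).trans ?_
  rw [← lintegral_const_mul _ (by fun_prop)]
  refine lintegral_mono fun x => ?_
  by_cases hx : ψ x = 0
  · simp [hx]
  · gcongr
    rw [← ofReal_norm]
    exact ENNReal.ofReal_le_ofReal ((hb.norm_fourier_le _).trans (hB x hx))

/-- Decay of the low frequency part away from the sphere carrying `ψ`, at frequencies at least
`1 / R`. -/
theorem exists_enorm_lowPart_le_decay {d : ℕ} (hd : 2 ≤ d) (A : ℝ) (hA : 0 ≤ A) :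
    ∃ C : ℝ, 0 ≤ C ∧ ∀ (lam R : ℝ), 0 < lam → 0 < R → 1 ≤ lam * R →
      ∀ b ψ : 𝓢(EuclideanSpace ℝ (Fin d), ℂ), IsLowPass (d + 1) A lam b →
      ∀ η : ℝ → ℝ≥0∞, Measurable η → (∀ r, r < R → η r = 0) → (∀ r, 2 * R < r → η r = 0) →
      (∀ x, ‖ψ x‖ₑ = η ‖x‖) →
      ∀ y, ‖lowPart b ψ y‖ₑ ≤
        ENNReal.ofReal (C * lam * (R ^ (d - 1))⁻¹ * ((1 + ‖y‖ / R) ^ (d + 1))⁻¹) *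
          ∫⁻ x, ‖ψ x‖ₑ := by
  obtain ⟨C, hC, hlow⟩ := exists_enorm_lowPart_le hd A ((d : ℝ) - 1) hA
    (by have : (2 : ℝ) ≤ d := by exact_mod_cast hd
        linarith) le_rfl
  refine ⟨C * 5 ^ (d + 1) + A * 4 ^ (d + 1), by positivity,
    fun lam R hlam hR hlR b ψ hb η hη hsupp hsupp' hψ y => ?_⟩
  have hdpow : lam ^ d * ((lam * R) ^ (d - 1))⁻¹ = lam * (R ^ (d - 1))⁻¹ := by
    have : lam ^ d = lam ^ (d - 1) * lam := by rw [← pow_succ, Nat.sub_add_cancel (by omega)]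
    rw [this, mul_pow]
    field_simp
  -- For |y| ≤ 4R the weight is bounded below and the uniform bound with β = d - 1 suffices. Beyond,
  -- |y - x| ≥ |y|/2 on the support of `ψ`, so the kernel itself decays.
  rcases le_or_gt ‖y‖ (4 * R) with hy | hy
  · refine (hlow lam R hlam hR b ψ hb η hη hsupp hψ y).trans
      (mul_le_mul_left (ENNReal.ofReal_le_ofReal ?_) _)
    have h5 : (1 + ‖y‖ / R) ^ (d + 1) ≤ 5 ^ (d + 1) := by
      gcongr
      have : ‖y‖ / R ≤ 4 := (div_le_iff₀ hR).2 hy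
      linarith
    have hr : (lam * R) ^ (-((d : ℝ) - 1)) = ((lam * R) ^ (d - 1))⁻¹ := by
      rw [Real.rpow_neg (by positivity), ← Real.rpow_natCast, Nat.cast_sub (by omega), Nat.cast_one]
    rw [hr, mul_assoc, hdpow]
    have h6 : 1 ≤ 5 ^ (d + 1) * ((1 + ‖y‖ / R) ^ (d + 1))⁻¹ := by
      rw [← div_eq_mul_inv, one_le_div (by positivity)]
      exact h5
    calc C * (lam * (R ^ (d - 1))⁻¹) = C * (lam * (R ^ (d - 1))⁻¹) * 1 := by ring
      _ ≤ C * (lam * (R ^ (d - 1))⁻¹) * (5 ^ (d + 1) * ((1 + ‖y‖ / R) ^ (d + 1))⁻¹) := by gcongr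
      _ = (C * 5 ^ (d + 1)) * lam * (R ^ (d - 1))⁻¹ * ((1 + ‖y‖ / R) ^ (d + 1))⁻¹ := by ring
      _ ≤ _ := by
        gcongr
        exact le_add_of_nonneg_right (by positivity)
  · refine hb.enorm_lowPart_le_of_kernel_le fun x hx => ?_
    have hx2 : ‖x‖ ≤ 2 * R := by
      by_contra! h
      have := hψ x
      rw [hsupp' _ h, enorm_eq_zero] at this
      exact hx this
    have hyx : ‖y‖ / 2 ≤ ‖y - x‖ := by
      have := norm_sub_norm_le y x
      linarith
    have h1 : lam * R * (1 + ‖y‖ / R) / 4 ≤ 1 + lam * ‖y - x‖ := by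
      have : lam * R * (1 + ‖y‖ / R) / 4 = lam * ((R + ‖y‖) / 4) := by field_simp
      rw [this]
      have : lam * ((R + ‖y‖) / 4) ≤ lam * ‖y - x‖ := by gcongr; linarith
      linarith
    -- Here lam * R ≥ 1 is used, to trade the exponent d + 1 of lam * R for d - 1.
    have h2 : ((1 + lam * ‖y - x‖) ^ (d + 1))⁻¹ ≤
        4 ^ (d + 1) * ((lam * R) ^ (d - 1))⁻¹ * ((1 + ‖y‖ / R) ^ (d + 1))⁻¹ := by
      calc ((1 + lam * ‖y - x‖) ^ (d + 1))⁻¹ ≤ ((lam * R * (1 + ‖y‖ / R) / 4) ^ (d + 1))⁻¹ :=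
            inv_anti₀ (by positivity) (pow_le_pow_left₀ (by positivity) h1 _)
        _ = 4 ^ (d + 1) * ((lam * R) ^ (d + 1))⁻¹ * ((1 + ‖y‖ / R) ^ (d + 1))⁻¹ := by
            rw [div_pow, mul_pow, inv_div]
            field_simp
        _ ≤ _ := by
            gcongr
            omega
    calc A * lam ^ d * ((1 + lam * ‖y - x‖) ^ (d + 1))⁻¹
        ≤ A * lam ^ d * (4 ^ (d + 1) * ((lam * R) ^ (d - 1))⁻¹ * ((1 + ‖y‖ / R) ^ (d + 1))⁻¹) := by
          gcongr
      _ = A * 4 ^ (d + 1) * (lam ^ d * ((lam * R) ^ (d - 1))⁻¹) * ((1 + ‖y‖ / R) ^ (d + 1))⁻¹ := by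
          ring
      _ = A * 4 ^ (d + 1) * lam * (R ^ (d - 1))⁻¹ * ((1 + ‖y‖ / R) ^ (d + 1))⁻¹ := by
          rw [hdpow]; ring
      _ ≤ _ := by
        gcongr
        exact le_add_of_nonneg_left (by positivity)

/-- Serves the case R < 1: kernel and support both live at scale 1, so no radial gain is needed. The
division by 1 matches the weight at scale T = 1. -/
theorem IsLowPass.enorm_lowPart_one_le {d : ℕ} {A : ℝ} (hA : 0 ≤ A)
    {b ψ : 𝓢(EuclideanSpace ℝ (Fin d), ℂ)} (hb : IsLowPass (d + 1) A 1 b)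
    (hψ : ∀ x, ψ x ≠ 0 → ‖x‖ ≤ 2) (y : EuclideanSpace ℝ (Fin d)) :
    ‖lowPart b ψ y‖ₑ ≤
      ENNReal.ofReal (A * 3 ^ (d + 1) * ((1 + ‖y‖ / 1) ^ (d + 1))⁻¹) * ∫⁻ x, ‖ψ x‖ₑ := by
  refine hb.enorm_lowPart_le_of_kernel_le fun x hx => ?_
  have h1 : (1 + ‖y‖) / 3 ≤ 1 + ‖y - x‖ := by
    have := norm_sub_norm_le y x
    have := hψ x hx
    have := norm_nonneg (y - x)
    linarith
  rw [one_pow, mul_one, one_mul, div_one, mul_assoc]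
  gcongr
  calc ((1 + ‖y - x‖) ^ (d + 1))⁻¹ ≤ (((1 + ‖y‖) / 3) ^ (d + 1))⁻¹ :=
        inv_anti₀ (by positivity) (pow_le_pow_left₀ (by positivity) h1 _)
    _ = _ := by rw [div_pow, inv_div, div_eq_mul_inv]

/-! ### High frequencies, Plancherel and the frequency splitting of the pairing. -/

/-- The high frequencies of a function of radial modulus carried by `{R ≤ ‖x‖}`, in the
homogeneous Sobolev space of order `-s`. -/
theorem exists_lintegral_high_frequency_le {d : ℕ} (hd : 2 ≤ d) (A β s : ℝ) (hA : 0 ≤ A)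
    (hβ : 0 ≤ β) (hβ' : β ≤ d - 1) (hβs : d - 2 * s < β)
    (hcut : ∀ lam : ℝ, 0 < lam →
      ∃ b : 𝓢(EuclideanSpace ℝ (Fin d), ℂ), IsLowPass (d + 1) A lam b) :
    ∃ C : ℝ, 0 ≤ C ∧ ∀ (ρ R : ℝ), 0 < ρ → 0 < R →
      ∀ ψ : 𝓢(EuclideanSpace ℝ (Fin d), ℂ),
      ∀ η : ℝ → ℝ≥0∞, Measurable η → (∀ r, r < R → η r = 0) → (∀ x, ‖ψ x‖ₑ = η ‖x‖) →
      ∫⁻ ξ in {ξ | ρ ≤ ‖ξ‖}, ENNReal.ofReal (‖ξ‖ ^ (-(2 * s))) * ‖𝓕⁻ ψ ξ‖ₑ ^ 2 ≤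
        ENNReal.ofReal (C * ρ ^ (d - 2 * s - β) * R ^ (-β)) * (∫⁻ x, ‖ψ x‖ₑ) ^ 2 := by
  obtain ⟨C, hC, hlow⟩ := exists_enorm_lowPart_le hd A β hA hβ hβ'
  choose! b hb using hcut
  -- Ratio of the dyadic series: the weight gives -2s per octave and the energy below λ grows like
  -- λ^(d-β).
  set q : ℝ := 2 ^ (d - 2 * s - β) with hq
  have hq0 : 0 < q := by positivity
  have hq1 : q < 1 := Real.rpow_lt_one_of_one_lt_of_neg one_lt_two (by linarith)
  have hqs : Summable fun k : ℕ => q ^ k := summable_geometric_of_lt_one hq0.le hq1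
  refine ⟨C * 2 ^ (d - β) * ∑' k : ℕ, q ^ k, by positivity, fun ρ R hρ hR ψ η hη hsupp hψ => ?_⟩
  set N := ∫⁻ x, ‖ψ x‖ₑ
  have hp : ∀ k : ℕ, 0 < 2 ^ k * ρ := fun k => by positivity
  -- On 2^k ρ ≤ |ξ| < 2^(k+1) ρ the cutoff at the upper end equals 1, so the k-th term dominates.
  have hpt : ∀ ξ ∈ {ξ : EuclideanSpace ℝ (Fin d) | ρ ≤ ‖ξ‖},
      ENNReal.ofReal (‖ξ‖ ^ (-(2 * s))) * ‖𝓕⁻ ψ ξ‖ₑ ^ 2 ≤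
      ∑' k : ℕ, ENNReal.ofReal ((2 ^ k * ρ) ^ (-(2 * s))) *
        (‖b (2 ^ (k + 1) * ρ) ξ‖ₑ * ‖𝓕⁻ ψ ξ‖ₑ ^ 2) := by
    intro ξ hξ
    have hξ : ρ ≤ ‖ξ‖ := hξ
    obtain ⟨k, hk1, hk2⟩ := exists_nat_pow_near ((one_le_div hρ).2 hξ) one_lt_two
    rw [le_div_iff₀ hρ] at hk1
    rw [div_lt_iff₀ hρ] at hk2
    refine le_trans ?_ (ENNReal.le_tsum k)
    rw [(hb _ (hp (k + 1))).eq_one ξ hk2.le, enorm_one, one_mul]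
    gcongr ?_ * _
    exact ENNReal.ofReal_le_ofReal (Real.rpow_le_rpow_of_nonpos (hp k) hk1 (by linarith))
  calc ∫⁻ ξ in {ξ | ρ ≤ ‖ξ‖}, ENNReal.ofReal (‖ξ‖ ^ (-(2 * s))) * ‖𝓕⁻ ψ ξ‖ₑ ^ 2
      ≤ ∫⁻ ξ in {ξ | ρ ≤ ‖ξ‖}, ∑' k : ℕ, ENNReal.ofReal ((2 ^ k * ρ) ^ (-(2 * s))) *
        (‖b (2 ^ (k + 1) * ρ) ξ‖ₑ * ‖𝓕⁻ ψ ξ‖ₑ ^ 2) :=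
        setLIntegral_mono' (measurableSet_le measurable_const measurable_norm) hpt
    _ ≤ ∑' k : ℕ, ENNReal.ofReal ((2 ^ k * ρ) ^ (-(2 * s))) *
        ∫⁻ ξ, ‖b (2 ^ (k + 1) * ρ) ξ‖ₑ * ‖𝓕⁻ ψ ξ‖ₑ ^ 2 := by
        refine (setLIntegral_le_lintegral _ _).trans ?_
        rw [lintegral_tsum fun k => by fun_prop]
        refine ENNReal.tsum_le_tsum fun k => ?_
        rw [lintegral_const_mul _ (by fun_prop)]
    _ ≤ ∑' k : ℕ, ENNReal.ofReal (C * 2 ^ (d - β) * ρ ^ (d - 2 * s - β) * R ^ (-β)) * N ^ 2 *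
        ENNReal.ofReal (q ^ k) := by
        refine ENNReal.tsum_le_tsum fun k => ?_
        have h2 : (0 : ℝ) < 2 ^ k := by positivity
        have hk := lintegral_cutoff_mul_fourierInv_sq_le (hb _ (hp (k + 1)))
          (hlow _ R (hp (k + 1)) hR _ ψ (hb _ (hp (k + 1))) η hη hsupp hψ)
        refine (mul_le_mul_right hk _).trans_eq ?_
        rw [mul_right_comm, mul_assoc (ENNReal.ofReal (C * _ * _)), ← sq, ← mul_assoc,
          ← ENNReal.ofReal_mul (by positivity), mul_right_comm _ (N ^ 2),
          ← ENNReal.ofReal_mul (by positivity)]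
        congr 2
        have hqk : q ^ k = (2 ^ k : ℝ) ^ (d - 2 * s - β) := by
          rw [hq, ← Real.rpow_natCast, ← Real.rpow_mul zero_le_two, ← Real.rpow_natCast 2 k,
            ← Real.rpow_mul zero_le_two, mul_comm]
        rw [hqk, ← Real.rpow_natCast _ d, pow_succ, mul_right_comm ((2 : ℝ) ^ k) 2 ρ,
          Real.mul_rpow (hp k).le zero_le_two,
          Real.mul_rpow (mul_pos (hp k) two_pos).le hR.le,
          Real.mul_rpow (hp k).le zero_le_two, Real.mul_rpow h2.le hρ.le,
          Real.mul_rpow h2.le hρ.le, Real.mul_rpow h2.le hρ.le]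
        have e1 : ∀ x : ℝ, 0 < x → x ^ (d - 2 * s - β) = x ^ (-(2 * s)) * x ^ (d : ℝ) * x ^ (-β) := by
          intro x hx
          rw [← Real.rpow_add hx, ← Real.rpow_add hx]
          congr 1; ring
        have e2 : (2 : ℝ) ^ (d - β) = 2 ^ (d : ℝ) * 2 ^ (-β) := by
          rw [← Real.rpow_add two_pos]; congr 1
        rw [e1 _ h2, e1 _ hρ, e2]
        ring
    _ = _ := by
        rw [ENNReal.tsum_mul_left, ← ENNReal.ofReal_tsum_of_nonneg (fun k => by positivity) hqs,
          mul_right_comm, ← ENNReal.ofReal_mul (by positivity)]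
        congr 2
        ring

/-- Plancherel for a tempered distribution represented by a function of `L²` and whose Fourier
transform is represented by a function. -/
theorem IsRepresentedBy.eLpNorm_fourier_eq {d : ℕ} {V : 𝓢'(EuclideanSpace ℝ (Fin d), ℂ)}
    {v h : EuclideanSpace ℝ (Fin d) → ℂ} (hV : IsRepresentedBy V v) (hv : MemLp v 2 volume)
    (hF : IsRepresentedBy (𝓕 V) h) : eLpNorm h 2 volume = eLpNorm v 2 volume := by
  have hVv : V = (hv.toLp v : 𝓢'(EuclideanSpace ℝ (Fin d), ℂ)) := by
    ext φ
    rw [(hV.2 φ).2, Lp.toTemperedDistribution_apply]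
    refine integral_congr_ae ?_
    filter_upwards [hv.coeFn_toLp] with x hx
    rw [hx, smul_eq_mul]
  set w : Lp (α := EuclideanSpace ℝ (Fin d)) ℂ 2 volume := 𝓕 (hv.toLp v)
  have hFw : 𝓕 V = (w : 𝓢'(EuclideanSpace ℝ (Fin d), ℂ)) := by
    rw [hVv, Lp.fourier_toTemperedDistribution_eq]
  have hae : h =ᵐ[volume] w := by
    refine ae_eq_of_integral_contDiff_smul_eq hF.1
      ((Lp.memLp w).locallyIntegrable one_le_two) fun g hg hgc => ?_
    have hg₁ : HasCompactSupport (Complex.ofRealCLM ∘ g) := hgc.comp_left rfl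
    have hg₂ : ContDiff ℝ (⊤ : ℕ∞) (Complex.ofRealCLM ∘ g) := by fun_prop
    have h1 := (hF.2 (hg₁.toSchwartzMap hg₂)).2
    rw [hFw, Lp.toTemperedDistribution_apply] at h1
    simpa using h1.symm
  rw [eLpNorm_congr_ae hae, ← eLpNorm_congr_ae hv.coeFn_toLp, ← Lp.enorm_def, ← Lp.enorm_def]
  rw [enorm_eq_iff_norm_eq]
  exact Lp.norm_fourier_eq _

/-- Pairing of `u` with a Schwartz function, split at the frequency `ρ`. -/
theorem IsFracDeriv.enorm_integral_mul_le {d M : ℕ} {s A ρ : ℝ} (hρ : 0 < ρ)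
    {u v : EuclideanSpace ℝ (Fin d) → ℂ} (h : IsFracDeriv s u v) (hv : MemLp v 2 volume)
    {b : 𝓢(EuclideanSpace ℝ (Fin d), ℂ)} (hb : IsLowPass M A ρ b)
    (ψ : 𝓢(EuclideanSpace ℝ (Fin d), ℂ)) :
    ‖∫ x, ψ x * u x‖ₑ ≤ (∫⁻ x, ‖lowPart b ψ x‖ₑ * ‖u x‖ₑ) +
      (∫⁻ ξ in {ξ | ρ ≤ ‖ξ‖}, ENNReal.ofReal (‖ξ‖ ^ (-(2 * s))) * ‖𝓕⁻ ψ ξ‖ₑ ^ 2) ^ (1 / 2 : ℝ) *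
        eLpNorm v 2 volume := by
  obtain ⟨U, V, g, hU, hV, hg, hVg⟩ := h
  set H := ψ - lowPart b ψ
  have hsplit : ∫ x, ψ x * u x = (∫ x, lowPart b ψ x * u x) + ∫ ξ, 𝓕⁻ H ξ * g ξ := by
    rw [← (hU.2 ψ).2, ← (hU.2 (lowPart b ψ)).2, ← (hg.2 (𝓕⁻ H)).2,
      TemperedDistribution.fourier_apply, FourierTransform.fourier_fourierInv_eq, ← map_add]
    congr 1
    simp [H]
  have hHξ : ∀ ξ, 𝓕⁻ H ξ = (1 - b ξ) * 𝓕⁻ ψ ξ := by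
    intro ξ
    have : 𝓕⁻ H = 𝓕⁻ ψ - 𝓕⁻ (lowPart b ψ) := map_sub (FourierTransform.fourierInvCLM ℂ _) ψ _
    rw [this, sub_apply, fourierInv_lowPart]
    ring
  have hmS : MeasurableSet {ξ : EuclideanSpace ℝ (Fin d) | ρ ≤ ‖ξ‖} :=
    measurableSet_le measurable_const measurable_norm
  set h : EuclideanSpace ℝ (Fin d) → ℂ := fun ξ => ((‖ξ‖ ^ s : ℝ) : ℂ) * g ξ with hh
  have hpt : ∀ ξ, ‖𝓕⁻ H ξ * g ξ‖ₑ ≤ {ξ : EuclideanSpace ℝ (Fin d) | ρ ≤ ‖ξ‖}.indicator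
      (fun ξ => ENNReal.ofReal (‖ξ‖ ^ (-s)) * ‖𝓕⁻ ψ ξ‖ₑ * ‖h ξ‖ₑ) ξ := by
    intro ξ
    -- Below ρ the factor 1 - b vanishes; above, |ξ|^(-s) |ξ|^s = 1 can be inserted since ξ ≠ 0.
    rw [hHξ]
    rcases lt_or_ge ‖ξ‖ ρ with hξ | hξ
    · simp [hb.eq_one ξ hξ.le]
    · have hξ0 : 0 < ‖ξ‖ := hρ.trans_le hξ
      have h1 : ‖1 - b ξ‖ₑ ≤ 1 := by
        obtain ⟨t, ht0, ht1, ht⟩ := hb.exists_real ξ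
        rw [ht, ← Complex.ofReal_one, ← Complex.ofReal_sub, ← ofReal_norm, Complex.norm_real,
          Real.norm_of_nonneg (by linarith), ENNReal.ofReal_le_one]
        linarith
      have h2 : ‖((‖ξ‖ ^ s : ℝ) : ℂ)‖ₑ = ENNReal.ofReal (‖ξ‖ ^ s) := by
        rw [← ofReal_norm, Complex.norm_real, Real.norm_of_nonneg (by positivity)]
      have h3 : ENNReal.ofReal (‖ξ‖ ^ (-s)) * ENNReal.ofReal (‖ξ‖ ^ s) = 1 := by
        rw [← ENNReal.ofReal_mul (by positivity), ← Real.rpow_add hξ0, neg_add_cancel,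
          Real.rpow_zero, ENNReal.ofReal_one]
      rw [Set.indicator_of_mem (by exact hξ)]
      simp only [hh, enorm_mul, h2]
      calc ‖1 - b ξ‖ₑ * ‖𝓕⁻ ψ ξ‖ₑ * ‖g ξ‖ₑ ≤ 1 * ‖𝓕⁻ ψ ξ‖ₑ * ‖g ξ‖ₑ := by gcongr
        _ = _ := by rw [← h3]; ring
  have hhm : AEMeasurable (fun ξ => ‖h ξ‖ₑ) volume := hVg.1.aestronglyMeasurable.enorm
  have hhigh : ‖∫ ξ, 𝓕⁻ H ξ * g ξ‖ₑ ≤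
      (∫⁻ ξ in {ξ | ρ ≤ ‖ξ‖}, ENNReal.ofReal (‖ξ‖ ^ (-(2 * s))) * ‖𝓕⁻ ψ ξ‖ₑ ^ 2) ^ (1 / 2 : ℝ) *
        eLpNorm v 2 volume := by
    calc ‖∫ ξ, 𝓕⁻ H ξ * g ξ‖ₑ ≤ ∫⁻ ξ, ‖𝓕⁻ H ξ * g ξ‖ₑ := enorm_integral_le_lintegral_enorm _
      _ ≤ ∫⁻ ξ in {ξ | ρ ≤ ‖ξ‖}, ((fun ξ => ENNReal.ofReal (‖ξ‖ ^ (-s)) * ‖𝓕⁻ ψ ξ‖ₑ) *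
          fun ξ => ‖h ξ‖ₑ) ξ := by
          rw [← lintegral_indicator hmS]
          exact lintegral_mono hpt
      _ ≤ _ := ENNReal.lintegral_mul_le_Lp_mul_Lq _ Real.HolderConjugate.two_two
          (by fun_prop) hhm.restrict
      _ ≤ _ := by
          gcongr ?_ * ?_
          · refine ENNReal.rpow_le_rpow ?_ (by norm_num)
            refine lintegral_mono fun ξ => ?_
            simp only [ENNReal.rpow_two, mul_pow]
            rw [← ENNReal.ofReal_pow (by positivity), ← Real.rpow_mul_natCast (norm_nonneg _)]
            have : -s * (2 : ℕ) = -(2 * s) := by push_cast; ring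
            rw [this]
          · rw [← hV.eLpNorm_fourier_eq hv hVg, eLpNorm_eq_lintegral_rpow_enorm_toReal two_ne_zero
              ENNReal.ofNat_ne_top, ENNReal.toReal_ofNat]
            exact ENNReal.rpow_le_rpow (setLIntegral_le_lintegral _ _) (by norm_num)
  rw [hsplit]
  refine (enorm_add_le _ _).trans (add_le_add ?_ hhigh)
  refine (enorm_integral_le_lintegral_enorm _).trans_eq ?_
  simp only [enorm_mul]

theorem rieszConv_eq {d : ℕ} (α : ℝ) (u : EuclideanSpace ℝ (Fin d) → ℂ)
    (z : EuclideanSpace ℝ (Fin d)) :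
    rieszConv α u z = ∫⁻ y, ENNReal.ofReal (‖z - y‖ ^ (-α)) * ‖u y‖ₑ := by
  rw [rieszConv, lconvolution_def, ← lintegral_sub_left_eq_self _ z]
  refine lintegral_congr fun y => ?_
  congr 3
  abel

/-! ### The pairing estimate and the choice of the cutting frequency. -/

/-- Weighted integrability of `u` when `|x|^{-α} ⋆ |u|` is normalized in `L²`. -/
theorem exists_lintegral_weight_le {d : ℕ} (hd : 2 ≤ d) (α : ℝ) (hα : 0 < α) (hα' : α < d) :
    ∃ C : ℝ, 0 ≤ C ∧ ∀ u : EuclideanSpace ℝ (Fin d) → ℂ, AEStronglyMeasurable u volume →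
      eLpNorm (rieszConv α u) 2 volume = 1 → ∀ R : ℝ, 0 < R →
      ∫⁻ y, ENNReal.ofReal (((1 + ‖y‖ / R) ^ (d + 1))⁻¹) * ‖u y‖ₑ ≤
        ENNReal.ofReal (C * R ^ (α - d / 2)) := by
  have : Nontrivial (EuclideanSpace ℝ (Fin d)) := by
    have : Nonempty (Fin d) := ⟨⟨0, by omega⟩⟩
    infer_instance
  set w := (volume : Measure (EuclideanSpace ℝ (Fin d))).real (Metric.ball 0 1) with hw
  have hw0 : 0 < w := ENNReal.toReal_pos (Metric.measure_ball_pos _ _ one_pos).ne'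
    measure_ball_lt_top.ne
  refine ⟨w ^ (-(1 / 2) : ℝ), by positivity, fun u hu hnorm R hR => ?_⟩
  set I := ∫⁻ y, ENNReal.ofReal (((1 + ‖y‖ / R) ^ (d + 1))⁻¹) * ‖u y‖ₑ with hI
  -- For |z| < R one has |z - y| ≤ R + |y| = R (1 + |y|/R), and α < d + 1. Squaring over this ball
  -- of volume of order R^d then bounds `I`.
  have hlower : ∀ z ∈ Metric.ball (0 : EuclideanSpace ℝ (Fin d)) R,
      ENNReal.ofReal (R ^ (-α)) * I ≤ rieszConv α u z := by
    intro z hz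
    rw [mem_ball_zero_iff] at hz
    rw [rieszConv_eq, hI, ← lintegral_const_mul'' _ (by fun_prop)]
    refine lintegral_mono_ae ?_
    -- The point y = z is excluded because `0 ^ (-α)` is 0 for the real power, so the lower bound
    -- fails there.
    filter_upwards [Measure.ae_ne volume z] with y hy
    rw [← mul_assoc, ← ENNReal.ofReal_mul (by positivity)]
    gcongr
    have hzy : 0 < ‖z - y‖ := norm_pos_iff.2 (sub_ne_zero.2 hy.symm)
    have h1 : (1 : ℝ) ≤ 1 + ‖y‖ / R := by
      have : 0 ≤ ‖y‖ / R := by positivity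
      linarith
    calc R ^ (-α) * ((1 + ‖y‖ / R) ^ (d + 1))⁻¹ ≤ R ^ (-α) * (1 + ‖y‖ / R) ^ (-α) := by
          gcongr
          rw [← Real.rpow_natCast, ← Real.rpow_neg (by positivity)]
          refine Real.rpow_le_rpow_of_exponent_le h1 ?_
          push_cast
          linarith
      _ = (R + ‖y‖) ^ (-α) := by
          rw [← Real.mul_rpow hR.le (by positivity)]
          congr 1
          field_simp
      _ ≤ ‖z - y‖ ^ (-α) := by
          refine Real.rpow_le_rpow_of_nonpos hzy ?_ (by linarith)
          linarith [norm_sub_le z y]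
  have hsq : (ENNReal.ofReal (R ^ (-α)) * I) ^ 2 * ENNReal.ofReal (R ^ d * w) ≤ 1 := by
    have h2 : ∫⁻ z, rieszConv α u z ^ 2 = 1 := by
      have h3 := hnorm
      rw [eLpNorm_eq_lintegral_rpow_enorm_toReal two_ne_zero ENNReal.ofNat_ne_top,
        ENNReal.toReal_ofNat] at h3
      have h4 := congrArg (fun t : ℝ≥0∞ => t ^ (2 : ℝ)) h3
      rw [← ENNReal.rpow_mul, one_div, inv_mul_cancel₀ two_ne_zero, ENNReal.rpow_one] at h4
      simpa using h4
    calc _ = ∫⁻ _ in Metric.ball (0 : EuclideanSpace ℝ (Fin d)) R,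
            (ENNReal.ofReal (R ^ (-α)) * I) ^ 2 := by
          rw [setLIntegral_const, Measure.addHaar_ball_of_pos _ _ hR, finrank_euclideanSpace_fin,
            ENNReal.ofReal_mul (by positivity), hw, ofReal_measureReal measure_ball_lt_top.ne]
      _ ≤ ∫⁻ z in Metric.ball (0 : EuclideanSpace ℝ (Fin d)) R, rieszConv α u z ^ 2 :=
          setLIntegral_mono' measurableSet_ball fun z hz => pow_le_pow_left' (hlower z hz) 2
      _ ≤ 1 := (setLIntegral_le_lintegral _ _).trans_eq h2
  have hroot : ENNReal.ofReal (R ^ (-α)) * I * ENNReal.ofReal (R ^ (d / 2 : ℝ) * w ^ (1 / 2 : ℝ)) ≤ 1 := by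
    rw [← pow_le_one_iff two_ne_zero, mul_pow, ← ENNReal.ofReal_pow (by positivity)]
    refine le_trans (le_of_eq ?_) hsq
    congr 2
    rw [mul_pow, ← Real.rpow_mul_natCast hR.le, ← Real.rpow_mul_natCast hw0.le]
    norm_num
  -- Multiplying by this explicit inverse isolates `I` without knowing beforehand that it is finite.
  have e : ENNReal.ofReal (R ^ (-α)) * ENNReal.ofReal (R ^ (d / 2 : ℝ) * w ^ (1 / 2 : ℝ)) *
      ENNReal.ofReal (w ^ (-(1 / 2) : ℝ) * R ^ (α - d / 2)) = 1 := by
    rw [← ENNReal.ofReal_mul (by positivity), ← ENNReal.ofReal_mul (by positivity),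
      ← ENNReal.ofReal_one]
    congr 1
    have h1 : w ^ (-(1 / 2) : ℝ) * w ^ (1 / 2 : ℝ) = 1 := by
      rw [← Real.rpow_add hw0]; norm_num
    have h2 : R ^ (-α) * R ^ (d / 2 : ℝ) * R ^ (α - d / 2) = 1 := by
      rw [← Real.rpow_add hR, ← Real.rpow_add hR, ← Real.rpow_zero R]
      congr 1; ring
    linear_combination h1 * (R ^ (-α) * R ^ (d / 2 : ℝ) * R ^ (α - d / 2)) + h2
  calc I = ENNReal.ofReal (R ^ (-α)) * I * ENNReal.ofReal (R ^ (d / 2 : ℝ) * w ^ (1 / 2 : ℝ)) *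
        ENNReal.ofReal (w ^ (-(1 / 2) : ℝ) * R ^ (α - d / 2)) := by
        rw [mul_right_comm (ENNReal.ofReal (R ^ (-α))), mul_right_comm _ I, e, one_mul]
    _ ≤ 1 * ENNReal.ofReal (w ^ (-(1 / 2) : ℝ) * R ^ (α - d / 2)) := by gcongr
    _ = _ := one_mul _

theorem ENNReal.ofReal_mul_sq_rpow_half {c x t : ℝ} (hc : 0 ≤ c) (hx : 0 < x) (N : ℝ≥0∞) :
    (ENNReal.ofReal (c * x ^ (2 * t)) * N ^ 2) ^ (1 / 2 : ℝ) = ENNReal.ofReal (√c * x ^ t) * N := by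
  have h : ENNReal.ofReal (c * x ^ (2 * t)) * N ^ 2 = (ENNReal.ofReal (√c * x ^ t) * N) ^ (2 : ℝ) := by
    rw [ENNReal.rpow_two, mul_pow, ← ENNReal.ofReal_pow (by positivity), mul_pow, Real.sq_sqrt hc,
      ← Real.rpow_mul_natCast hx.le, mul_comm t]
    simp
  rw [h, ← ENNReal.rpow_mul, mul_one_div_cancel two_ne_zero, ENNReal.rpow_one]

/-- The pairing of `u` with a function of radial modulus carried by `{R ≤ ‖x‖ ≤ 2R}`. -/
theorem exists_enorm_pairing_le (d : ℕ) (hd : 2 ≤ d) (s α σ : ℝ) (hs : 1 / 2 < s)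
    (hα : (d : ℝ) / 2 < α) (hα' : α < d)
    (hσ : (2 * s * ((d : ℝ) / 2 - 1) + (d : ℝ) / 2) / (2 * s + 1) < σ)
    (hσ' : σ < (2 * s * ((d : ℝ) - 1) - (2 * s - 1) * (α - (d : ℝ) / 2)) / (2 * s + 1)) :
    ∃ C : ℝ, 0 ≤ C ∧ ∀ u v : EuclideanSpace ℝ (Fin d) → ℂ, IsFracDeriv s u v →
      eLpNorm v 2 volume = 1 → eLpNorm (rieszConv α u) 2 volume = 1 →
      ∀ R : ℝ, 0 < R → ∀ ψ : 𝓢(EuclideanSpace ℝ (Fin d), ℂ),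
      ∀ η : ℝ → ℝ≥0∞, Measurable η → (∀ r, r < R → η r = 0) → (∀ r, 2 * R < r → η r = 0) →
      (∀ x, ‖ψ x‖ₑ = η ‖x‖) →
      ‖∫ x, ψ x * u x‖ₑ ≤ ENNReal.ofReal (C * R ^ (-σ)) * ∫⁻ x, ‖ψ x‖ₑ := by
  have hd' : (2 : ℝ) ≤ d := by exact_mod_cast hd
  have hs1 : 0 < 2 * s + 1 := by linarith
  rw [div_lt_iff₀ hs1] at hσ
  set σ' := (2 * s * ((d : ℝ) - 1) - (2 * s - 1) * (α - (d : ℝ) / 2)) / (2 * s + 1) with hσ'_def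
  have hσ'_mul : σ' * (2 * s + 1) = 2 * s * ((d : ℝ) - 1) - (2 * s - 1) * (α - (d : ℝ) / 2) :=
    div_mul_cancel₀ _ hs1.ne'
  have hσ0 : 0 < σ := by
    by_contra! h
    nlinarith
  have hσs : d / 2 - s < σ := by
    by_contra! h
    nlinarith
  -- Half the exponent β used for R < 1. It must satisfy γ ≤ σ for the final bound, 2γ ≤ d - 1 for
  -- the geometric gain, and 2γ > d - 2s for the dyadic sum; the last rests on σ > d/2 - s and s >
  -- 1/2.
  set γ := min σ (((d : ℝ) - 1) / 2) with hγ
  have hγ0 : 0 ≤ γ := le_min hσ0.le (by linarith)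
  have hγσ : γ ≤ σ := min_le_left _ _
  have hγd : γ ≤ ((d : ℝ) - 1) / 2 := min_le_right _ _
  have hγs : d / 2 - s < γ := lt_min hσs (by linarith)
  obtain ⟨A, hA, hcut⟩ := exists_isLowPass d (d + 1)
  obtain ⟨C₁, hC₁, hlow⟩ := exists_enorm_lowPart_le_decay hd A hA
  obtain ⟨C₂, hC₂, hweight⟩ := exists_lintegral_weight_le hd α (by linarith) hα'
  obtain ⟨C₃, hC₃, hhigh⟩ := exists_lintegral_high_frequency_le hd A ((d : ℝ) - 1) s hA
    (by linarith) le_rfl (by linarith) hcut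
  obtain ⟨C₄, hC₄, hhigh'⟩ := exists_lintegral_high_frequency_le hd A (2 * γ) s hA
    (by linarith) (by linarith) (by linarith) hcut
  refine ⟨C₁ * C₂ + √C₃ + A * 3 ^ (d + 1) * C₂ + √C₄, by positivity,
    fun u v huv hv hu R hR ψ η hη hsupp hsupp' hψ => ?_⟩
  obtain ⟨hum, hvm⟩ : AEStronglyMeasurable u volume ∧ AEStronglyMeasurable v volume := by
    obtain ⟨U, V, g, hU, hV, -, -⟩ := huv
    exact ⟨hU.1.aestronglyMeasurable, hV.1.aestronglyMeasurable⟩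
  have hvL : MemLp v 2 volume := ⟨hvm, by rw [hv]; exact ENNReal.one_lt_top⟩
  set N := ∫⁻ x, ‖ψ x‖ₑ with hN
  have hlowint : ∀ (b : 𝓢(EuclideanSpace ℝ (Fin d), ℂ)) (c T : ℝ), 0 ≤ c → 0 < T →
      (∀ y, ‖lowPart b ψ y‖ₑ ≤ ENNReal.ofReal (c * ((1 + ‖y‖ / T) ^ (d + 1))⁻¹) * N) →
      ∫⁻ x, ‖lowPart b ψ x‖ₑ * ‖u x‖ₑ ≤ ENNReal.ofReal (c * (C₂ * T ^ (α - d / 2))) * N := by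
    intro b c T hc hT h
    calc ∫⁻ x, ‖lowPart b ψ x‖ₑ * ‖u x‖ₑ
        ≤ ∫⁻ x, ENNReal.ofReal c * N * (ENNReal.ofReal (((1 + ‖x‖ / T) ^ (d + 1))⁻¹) * ‖u x‖ₑ) := by
          refine lintegral_mono fun x => ?_
          refine (mul_le_mul_left (h x) _).trans_eq ?_
          rw [ENNReal.ofReal_mul hc]
          ring
      _ = ENNReal.ofReal c * N *
            ∫⁻ x, ENNReal.ofReal (((1 + ‖x‖ / T) ^ (d + 1))⁻¹) * ‖u x‖ₑ :=
          lintegral_const_mul'' _ (by fun_prop)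
      _ ≤ ENNReal.ofReal c * N * ENNReal.ofReal (C₂ * T ^ (α - d / 2)) := by
          gcongr
          exact hweight u hum hu T hT
      _ = _ := by rw [ENNReal.ofReal_mul hc]; ring
  rcases le_or_gt 1 R with h1R | hR1
  -- The frequency R^τ solves ρ R^(1-d+α-d/2) = ρ^(1/2-s) R^(-(d-1)/2), and both sides then equal
  -- R^(-σ'). Since α < d, τ ≥ -1, whence ρR ≥ 1.
  · set τ := (2 * d - 1 - 2 * α) / (2 * s + 1) with hτ
    have hτ_mul : τ * (2 * s + 1) = 2 * d - 1 - 2 * α := div_mul_cancel₀ _ hs1.ne'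
    have hτ1 : 0 ≤ τ + 1 := by
      by_contra! h
      nlinarith
    set ρ := R ^ τ with hρ_def
    have hρ : 0 < ρ := by positivity
    have hρR : 1 ≤ ρ * R := by
      rw [hρ_def, ← Real.rpow_add_one hR.ne']
      exact Real.one_le_rpow h1R hτ1
    have hσ'le : R ^ (-σ') ≤ R ^ (-σ) := Real.rpow_le_rpow_of_exponent_le h1R (by linarith)
    obtain ⟨b, hb⟩ := hcut ρ hρ
    have hL := hlowint b (C₁ * ρ * (R ^ (d - 1))⁻¹) R (by positivity) hR
      (hlow ρ R hρ hR hρR b ψ hb η hη hsupp hsupp' hψ)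
    have hH := hhigh ρ R hρ hR ψ η hη hsupp hψ
    have eL : C₁ * ρ * (R ^ (d - 1))⁻¹ * (C₂ * R ^ (α - d / 2)) = C₁ * C₂ * R ^ (-σ') := by
      have h1 : (R ^ (d - 1))⁻¹ = R ^ (-((d : ℝ) - 1)) := by
        rw [Real.rpow_neg hR.le, ← Real.rpow_natCast, Nat.cast_sub (by omega), Nat.cast_one]
      have h2 : R ^ (-σ') = R ^ τ * R ^ (-((d : ℝ) - 1)) * R ^ (α - d / 2) := by
        rw [← Real.rpow_add hR, ← Real.rpow_add hR]
        congr 1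
        apply mul_right_cancel₀ hs1.ne'
        linear_combination -hσ'_mul - hτ_mul
      rw [h1, h2, hρ_def]
      ring
    have eH : C₃ * ρ ^ (d - 2 * s - ((d : ℝ) - 1)) * R ^ (-((d : ℝ) - 1)) =
        C₃ * R ^ (2 * (-σ')) := by
      rw [hρ_def, ← Real.rpow_mul hR.le, mul_assoc, ← Real.rpow_add hR]
      congr 2
      apply mul_right_cancel₀ hs1.ne'
      linear_combination 2 * hσ'_mul + (1 - 2 * s) * hτ_mul
    rw [eL] at hL
    rw [eH] at hH
    calc ‖∫ x, ψ x * u x‖ₑ ≤ _ := huv.enorm_integral_mul_le hρ hvL hb ψ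
      _ ≤ ENNReal.ofReal (C₁ * C₂ * R ^ (-σ')) * N + ENNReal.ofReal (√C₃ * R ^ (-σ')) * N := by
          rw [hv, mul_one, ← ENNReal.ofReal_mul_sq_rpow_half hC₃ hR]
          gcongr
      _ = ENNReal.ofReal ((C₁ * C₂ + √C₃) * R ^ (-σ')) * N := by
          rw [← add_mul, ← ENNReal.ofReal_add (by positivity) (by positivity), ← add_mul]
      _ ≤ _ := by
          refine mul_le_mul_left (ENNReal.ofReal_le_ofReal
            (mul_le_mul ?_ hσ'le (by positivity) (by positivity))) _
          have : 0 ≤ A * 3 ^ (d + 1) * C₂ := by positivity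
          have := Real.sqrt_nonneg C₄
          linarith
  · obtain ⟨b, hb⟩ := hcut 1 one_pos
    have hψ2 : ∀ x, ψ x ≠ 0 → ‖x‖ ≤ 2 := by
      intro x hx
      by_contra! h
      have := hψ x
      rw [hsupp' _ (by linarith), enorm_eq_zero] at this
      exact hx this
    have hL := hlowint b (A * 3 ^ (d + 1)) 1 (by positivity) one_pos
      (hb.enorm_lowPart_one_le hA hψ2)
    have hH := hhigh' 1 R one_pos hR ψ η hη hsupp hψ
    rw [Real.one_rpow, mul_one] at hL hH
    rw [show -(2 * γ) = 2 * (-γ) by ring] at hH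
    have h1 : R ^ (-γ) ≤ R ^ (-σ) :=
      Real.rpow_le_rpow_of_exponent_ge hR hR1.le (by linarith)
    have h2 : 1 ≤ R ^ (-σ) := Real.one_le_rpow_of_pos_of_le_one_of_nonpos hR hR1.le (by linarith)
    calc ‖∫ x, ψ x * u x‖ₑ ≤ _ := huv.enorm_integral_mul_le one_pos hvL hb ψ
      _ ≤ ENNReal.ofReal (A * 3 ^ (d + 1) * C₂) * N + ENNReal.ofReal (√C₄ * R ^ (-γ)) * N := by
          rw [hv, mul_one, ← ENNReal.ofReal_mul_sq_rpow_half hC₄ hR]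
          gcongr
      _ = ENNReal.ofReal (A * 3 ^ (d + 1) * C₂ * 1 + √C₄ * R ^ (-γ)) * N := by
          rw [← add_mul, ← ENNReal.ofReal_add (by positivity) (by positivity), mul_one]
      _ ≤ ENNReal.ofReal (A * 3 ^ (d + 1) * C₂ * R ^ (-σ) + √C₄ * R ^ (-σ)) * N := by
          gcongr
      _ ≤ _ := by
          rw [← add_mul]
          refine mul_le_mul_left (ENNReal.ofReal_le_ofReal
            (mul_le_mul_of_nonneg_right ?_ (by positivity))) _
          have : 0 ≤ C₁ * C₂ := by positivity
          have := Real.sqrt_nonneg C₃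
          linarith

/-! ### From pairings with radial bumps to pointwise bounds. -/

section Radial

open Filter Topology Convolution

theorem lintegral_fun_norm_addHaar {E : Type*} [NormedAddCommGroup E] [NormedSpace ℝ E]
    [MeasurableSpace E] [BorelSpace E] [FiniteDimensional ℝ E] [Nontrivial E] (μ : Measure E)
    [μ.IsAddHaarMeasure] {η : ℝ → ℝ≥0∞} (hη : Measurable η) :
    ∫⁻ x, η ‖x‖ ∂μ = μ.toSphere Set.univ *
      ∫⁻ r in Set.Ioi (0 : ℝ), ENNReal.ofReal (r ^ (Module.finrank ℝ E - 1)) * η r := by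
  rw [lintegral_eq_lintegral_polar μ (F := fun x => η ‖x‖) (hη.comp measurable_norm)]
  have h : ∀ r : Set.Ioi (0 : ℝ), ∫⁻ θ : Metric.sphere (0 : E) 1,
      η ‖(r : ℝ) • (θ : E)‖ ∂μ.toSphere = μ.toSphere Set.univ * η r := by
    rintro ⟨r, hr⟩
    have hr : 0 < r := hr
    simp [norm_smul, abs_of_pos hr, mul_comm]
  simp only [h]
  rw [lintegral_const_mul _ (by fun_prop), Measure.volumeIoiPow,
    lintegral_withDensity_eq_lintegral_mul _ (by fun_prop) (by fun_prop),
    ← lintegral_subtype_comap measurableSet_Ioi]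
  rfl

/-- A null set of radii sweeps out a null set of points, by polar coordinates. As `p` is arbitrary,
the exceptional set is first enlarged to a measurable null set. -/
theorem ae_norm_of_ae_pos {E : Type*} [NormedAddCommGroup E] [NormedSpace ℝ E]
    [MeasurableSpace E] [BorelSpace E] [FiniteDimensional ℝ E] [Nontrivial E] (μ : Measure E)
    [μ.IsAddHaarMeasure] {p : ℝ → Prop} (hp : ∀ᵐ r : ℝ, p r) : ∀ᵐ x ∂μ, p ‖x‖ := by
  set t := toMeasurable volume {r : ℝ | ¬ p r} with ht
  have ht0 : volume t = 0 := by rw [ht, measure_toMeasurable]; exact hp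
  have htm : MeasurableSet t := measurableSet_toMeasurable _ _
  have h0 : μ ((fun x : E => ‖x‖) ⁻¹' t) = 0 := by
    have h := lintegral_fun_norm_addHaar μ (η := t.indicator 1) (measurable_one.indicator htm)
    have h1 : ∫⁻ r in Set.Ioi (0 : ℝ), ENNReal.ofReal (r ^ (Module.finrank ℝ E - 1)) *
        t.indicator 1 r = 0 := by
      rw [lintegral_eq_zero_iff' (by fun_prop)]
      refine ae_restrict_of_ae ?_
      have : ∀ᵐ r : ℝ, r ∉ t := measure_eq_zero_iff_ae_notMem.1 ht0
      filter_upwards [this] with r hr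
      simp [hr]
    rw [h1, mul_zero] at h
    rw [← lintegral_indicator_one (measurable_norm htm), ← h]
    rfl
  refine measure_mono_null (fun x hx => ?_) h0
  exact subset_toMeasurable volume _ hx

theorem ContDiffBump.normed_eq_zero_of_rOut_le_abs (φ : ContDiffBump (0 : ℝ)) {r : ℝ}
    (hr : φ.rOut ≤ |r|) : φ.normed volume r = 0 := by
  rw [← Function.notMem_support, φ.support_normed_eq, mem_ball_zero_iff, Real.norm_eq_abs]
  exact not_lt.2 hr

variable {d : ℕ}

/-- A smooth bump of the distance to the origin, concentrated around the sphere of radius `r₀`. -/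
theorem exists_schwartz_radial_bump (φ : ContDiffBump (0 : ℝ)) {r₀ : ℝ} (h : φ.rOut < r₀) :
    ∃ ψ : 𝓢(EuclideanSpace ℝ (Fin d), ℂ), ∀ x, ψ x = (φ.normed volume (r₀ - ‖x‖) : ℝ) := by
  have hsm : ContDiff ℝ (⊤ : ℕ∞) fun x : EuclideanSpace ℝ (Fin d) =>
      ((φ.normed volume (r₀ - ‖x‖) : ℝ) : ℂ) := by
    refine Complex.ofRealCLM.contDiff.comp ?_
    rw [contDiff_iff_contDiffAt]
    intro x
    -- The norm is not smooth at the origin, but the bump vanishes identically near it because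
    -- `φ.rOut < r₀`.
    by_cases hx : x = 0
    · have hev : (fun x : EuclideanSpace ℝ (Fin d) => φ.normed volume (r₀ - ‖x‖)) =ᶠ[𝓝 x]
          fun _ => 0 := by
        have hlt : ∀ᶠ y in 𝓝 x, ‖y‖ < r₀ - φ.rOut :=
          continuous_norm.continuousAt.eventually_lt_const (by simpa [hx] using h)
        filter_upwards [hlt] with y hy
        apply φ.normed_eq_zero_of_rOut_le_abs
        rw [abs_of_nonneg] <;> linarith [φ.rOut_pos]
      exact contDiffAt_const.congr_of_eventuallyEq hev
    · exact φ.contDiff_normed.contDiffAt.comp x (contDiffAt_const.sub (contDiffAt_norm ℝ hx))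
  have hsupp : HasCompactSupport fun x : EuclideanSpace ℝ (Fin d) =>
      ((φ.normed volume (r₀ - ‖x‖) : ℝ) : ℂ) := by
    refine HasCompactSupport.intro (isCompact_closedBall 0 (r₀ + φ.rOut)) fun x hx => ?_
    rw [mem_closedBall_zero_iff, not_le] at hx
    rw [φ.normed_eq_zero_of_rOut_le_abs (by rw [abs_sub_comm, abs_of_nonneg] <;> linarith [φ.rOut_pos]), Complex.ofReal_zero]
  exact ⟨hsupp.toSchwartzMap hsm, fun x => rfl⟩

/-- A radial function whose pairings with radial bumps are controlled is controlled pointwise. -/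
theorem ae_norm_le_of_pairing_le (hd : 2 ≤ d) {u : EuclideanSpace ℝ (Fin d) → ℂ}
    (hu : LocallyIntegrable u volume) (hrad : IsRadial u) (K : ℝ → ℝ) (hK : ∀ R, 0 < R → 0 ≤ K R)
    (hpair : ∀ R : ℝ, 0 < R → ∀ ψ : 𝓢(EuclideanSpace ℝ (Fin d), ℂ),
      ∀ η : ℝ → ℝ≥0∞, Measurable η → (∀ r, r < R → η r = 0) → (∀ r, 2 * R < r → η r = 0) →
      (∀ x, ‖ψ x‖ₑ = η ‖x‖) →
      ‖∫ x, ψ x * u x‖ₑ ≤ ENNReal.ofReal (K R) * ∫⁻ x, ‖ψ x‖ₑ) :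
    ∀ᵐ x, x ≠ 0 → ‖u x‖ ≤ K (3 / 4 * ‖x‖) := by
  have : Nontrivial (EuclideanSpace ℝ (Fin d)) := by
    have : Nonempty (Fin d) := ⟨⟨0, by omega⟩⟩
    infer_instance
  obtain ⟨f, hf⟩ := hrad
  have hfloc : LocallyIntegrable (fun x : EuclideanSpace ℝ (Fin d) => f ‖x‖) volume :=
    hu.congr hf
  have hint : ∀ r : ℝ, IntegrableOn (fun y : ℝ => y ^ (d - 1) • f y) (Set.Ioo 0 r) := by
    intro r
    have := (integrableOn_fun_norm_addHaar (volume : Measure (EuclideanSpace ℝ (Fin d)))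
      (f := f) (r := r)).1
      ((hfloc.integrableOn_isCompact (isCompact_closedBall 0 r)).mono_set
        Metric.ball_subset_closedBall)
    rwa [finrank_euclideanSpace_fin] at this
  -- The profile `f` need not be integrable near 0 without the Jacobian r^(d-1). Up to the same
  -- factor κ, the pairing and ‖ψ‖₁ are mollifications of `G₁` and `G₂` at r₀, so in the limit the
  -- Jacobian cancels from the inequality.
  set G₁ : ℝ → ℂ := (Set.Ioi 0).indicator fun y => y ^ (d - 1) • f y with hG₁
  set G₂ : ℝ → ℝ := (Set.Ioi 0).indicator fun y => y ^ (d - 1) with hG₂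
  have hG₁loc : LocallyIntegrable G₁ volume := by
    rw [locallyIntegrable_iff]
    intro k hk
    obtain ⟨r, hr⟩ := hk.isBounded.subset_ball 0
    refine IntegrableOn.mono_set ?_ hr
    rw [hG₁, integrableOn_indicator_iff measurableSet_Ioi]
    refine (hint r).mono_set ?_
    rintro y ⟨hy0, hy⟩
    rw [mem_ball_zero_iff, Real.norm_eq_abs] at hy
    exact ⟨hy0, (abs_lt.1 hy).2⟩
  have hG₂loc : LocallyIntegrable G₂ volume :=
    ((continuous_pow (d - 1)).locallyIntegrable).indicator measurableSet_Ioi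
  -- The outer radius is twice the inner one, since differentiation along bumps needs a bounded
  -- ratio of radii.
  set φ : ℕ → ContDiffBump (0 : ℝ) := fun i =>
    ⟨1 / (i + 1), 2 * (1 / (i + 1)), by positivity, by
      have : (0 : ℝ) < 1 / (i + 1) := by positivity
      linarith⟩ with hφ
  have hφlim : Tendsto (fun i => (φ i).rOut) atTop (𝓝 0) := by
    simpa only [mul_zero] using
      (tendsto_one_div_add_atTop_nhds_zero_nat (𝕜 := ℝ)).const_mul (2 : ℝ)
  have hφK : ∀ᶠ i in atTop, (φ i).rOut ≤ 2 * (φ i).rIn := Eventually.of_forall fun i => le_rfl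
  set κ := d * (volume : Measure (EuclideanSpace ℝ (Fin d))).real (Metric.ball 0 1) with hκ
  have hκ0 : 0 < κ := by
    have : 0 < (volume : Measure (EuclideanSpace ℝ (Fin d))).real (Metric.ball 0 1) :=
      ENNReal.toReal_pos (Metric.measure_ball_pos _ _ one_pos).ne' measure_ball_lt_top.ne
    have : (0 : ℝ) < d := by exact_mod_cast (by omega : 0 < d)
    positivity
  have hpolar : ∀ {F : Type} [NormedAddCommGroup F] [NormedSpace ℝ F] (f : ℝ → F),
      ∫ x : EuclideanSpace ℝ (Fin d), f ‖x‖ =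
        κ • ∫ y, (Set.Ioi (0 : ℝ)).indicator (fun y => y ^ (d - 1) • f y) y := by
    intro F _ _ f
    rw [integral_fun_norm_addHaar, finrank_euclideanSpace_fin, integral_indicator measurableSet_Ioi,
      hκ, mul_smul, ← Nat.cast_smul_eq_nsmul ℝ]
  have hae : ∀ᵐ r : ℝ, 0 < r → ‖f r‖ ≤ K (3 / 4 * r) := by
    filter_upwards [ContDiffBump.ae_convolution_tendsto_right_of_locallyIntegrable hφlim hφK hG₁loc,
      ContDiffBump.ae_convolution_tendsto_right_of_locallyIntegrable hφlim hφK hG₂loc]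
      with r₀ h₁ h₂ hr₀
    have hev : ∀ᶠ i in atTop, ‖((φ i).normed volume ⋆[ContinuousLinearMap.lsmul ℝ ℝ, volume] G₁) r₀‖ ≤
        K (3 / 4 * r₀) * ((φ i).normed volume ⋆[ContinuousLinearMap.lsmul ℝ ℝ, volume] G₂) r₀ := by
      -- With radius below r₀/4 the bump lives in [3r₀/4, 5r₀/4], inside [R, 2R] for R = 3r₀/4.
      filter_upwards [hφlim.eventually_lt_const (show (0 : ℝ) < r₀ / 4 by linarith)] with i hi
      obtain ⟨ψ, hψ⟩ := exists_schwartz_radial_bump (d := d) (φ i) (r₀ := r₀) (by linarith)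
      have hb := hpair (3 / 4 * r₀) (by linarith) ψ (fun r => ‖(φ i).normed volume (r₀ - r)‖ₑ)
        (by
          have := (φ i).continuous_normed (μ := (volume : Measure ℝ))
          exact (this.comp (continuous_const.sub continuous_id)).enorm.measurable)
        (fun r hr => by
          simp only [enorm_eq_zero]
          refine (φ i).normed_eq_zero_of_rOut_le_abs ?_
          rw [abs_of_nonneg] <;> linarith [(φ i).rOut_pos])
        (fun r hr => by
          simp only [enorm_eq_zero]
          refine (φ i).normed_eq_zero_of_rOut_le_abs ?_
          rw [abs_sub_comm, abs_of_nonneg] <;> linarith [(φ i).rOut_pos])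
        (fun x => by rw [hψ, ← ofReal_norm, ← ofReal_norm, Complex.norm_real])
      have e₁ : ∫ x, ψ x * u x =
          κ • ((φ i).normed volume ⋆[ContinuousLinearMap.lsmul ℝ ℝ, volume] G₁) r₀ := by
        have : ∫ x, ψ x * u x = ∫ x : EuclideanSpace ℝ (Fin d),
            (fun r => (φ i).normed volume (r₀ - r) • f r) ‖x‖ := by
          refine integral_congr_ae ?_
          filter_upwards [hf] with x hx
          simp [hψ, hx]
        rw [this]
        refine (hpolar fun r => (φ i).normed volume (r₀ - r) • f r).trans ?_
        rw [convolution_eq_swap]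
        congr 2
        ext y
        by_cases hy : 0 < y
        · simp only [hG₁, Set.indicator_of_mem (Set.mem_Ioi.2 hy), ContinuousLinearMap.lsmul_apply]
          rw [smul_comm]
        · simp [hG₁, hy]
      have e₂ : ∫⁻ x, ‖ψ x‖ₑ = ENNReal.ofReal
          (κ * ((φ i).normed volume ⋆[ContinuousLinearMap.lsmul ℝ ℝ, volume] G₂) r₀) := by
        rw [← ofReal_integral_norm_eq_lintegral_enorm ψ.integrable]
        congr 1
        have : ∫ x, ‖ψ x‖ = ∫ x : EuclideanSpace ℝ (Fin d),
            (fun r => (φ i).normed volume (r₀ - r)) ‖x‖ := by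
          refine integral_congr_ae (.of_forall fun x => ?_)
          simp only [hψ, Complex.norm_real, Real.norm_of_nonneg ((φ i).nonneg_normed _)]
        rw [this]
        refine (hpolar fun r => (φ i).normed volume (r₀ - r)).trans ?_
        rw [convolution_eq_swap, smul_eq_mul]
        congr 2
        ext y
        by_cases hy : 0 < y
        · simp only [hG₂, Set.indicator_of_mem (Set.mem_Ioi.2 hy), ContinuousLinearMap.lsmul_apply,
            smul_eq_mul]
          rw [mul_comm]
        · simp [hG₂, hy]
      have hpos : 0 ≤ κ * ((φ i).normed volume ⋆[ContinuousLinearMap.lsmul ℝ ℝ, volume] G₂) r₀ := by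
        refine mul_nonneg hκ0.le (integral_nonneg fun t => ?_)
        refine smul_nonneg ((φ i).nonneg_normed _) (Set.indicator_nonneg (fun y hy => ?_) _)
        exact pow_nonneg (le_of_lt hy) _
      rw [e₁, e₂, ← ENNReal.ofReal_mul (hK _ (by linarith)), ← ofReal_norm,
        ENNReal.ofReal_le_ofReal_iff (mul_nonneg (hK _ (by linarith)) hpos), norm_smul,
        Real.norm_of_nonneg hκ0.le, mul_left_comm] at hb
      exact le_of_mul_le_mul_left hb hκ0
    have hlim := le_of_tendsto_of_tendsto h₁.norm (h₂.const_mul _) hev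
    rw [hG₁, hG₂, Set.indicator_of_mem (Set.mem_Ioi.2 hr₀), Set.indicator_of_mem (Set.mem_Ioi.2 hr₀),
      norm_smul, Real.norm_of_nonneg (by positivity), mul_comm] at hlim
    exact le_of_mul_le_mul_right hlim (by positivity)
  filter_upwards [ae_norm_of_ae_pos (volume : Measure (EuclideanSpace ℝ (Fin d))) hae, hf]
    with x hx hfx hx0
  rw [hfx]
  exact hx (norm_pos_iff.2 hx0)

end Radial

theorem mainTheorem5 (d : ℕ) (hd : 2 ≤ d) (s α σ : ℝ) (hs : 1 / 2 < s)
    (hα : (d : ℝ) / 2 < α) (hα' : α < d)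
    (hσ : (2 * s * ((d : ℝ) / 2 - 1) + (d : ℝ) / 2) / (2 * s + 1) < σ)
    (hσ' : σ < (2 * s * ((d : ℝ) - 1) - (2 * s - 1) * (α - (d : ℝ) / 2)) / (2 * s + 1)) :
    ∃ C : ℝ, 0 < C ∧
      ∀ u ∈ spaceX d s α, ∀ v : EuclideanSpace ℝ (Fin d) → ℂ, IsFracDeriv s u v →
        eLpNorm v 2 volume = 1 → eLpNorm (rieszConv α u) 2 volume = 1 →
        ∀ᵐ x ∂(volume : Measure (EuclideanSpace ℝ (Fin d))), ‖u x‖ ≤ C * ‖x‖ ^ (-σ) := by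
  obtain ⟨C, hC, hpair⟩ := exists_enorm_pairing_le d hd s α σ hs hα hα' hσ hσ'
  -- The factor (3/4)^(-σ) comes from R = 3|x|/4; adding 1 makes the constant positive.
  refine ⟨C * (3 / 4) ^ (-σ) + 1, by positivity, fun u hu v huv hv hru => ?_⟩
  have : Nontrivial (EuclideanSpace ℝ (Fin d)) := by
    have : Nonempty (Fin d) := ⟨⟨0, by omega⟩⟩
    infer_instance
  have huloc : LocallyIntegrable u volume := by
    obtain ⟨U, V, g, hU, -⟩ := huv
    exact hU.1
  filter_upwards [ae_norm_le_of_pairing_le hd huloc hu.2.1 (fun R => C * R ^ (-σ))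
    (fun R hR => by positivity) (hpair u v huv hv hru), Measure.ae_ne volume 0] with x hx hx0
  refine (hx hx0).trans ?_
  rw [Real.mul_rpow (by norm_num) (norm_nonneg _), ← mul_assoc]
  gcongr
  linarith
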